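/- **Setting.** Let $(X,d)$ be a compact metric space and $T:X\to X$ continuous. For $M\ge1$ put $d_M(x,y)=\max_{0\le m<M}d(T^mx,T^my)$ and $B_{d_M}(x,r)=\{y: d_M(x,y)\le r\}$; for $K\subset X$ and $\varepsilon>0$ let $N_{d_M}(K,\varepsilon)$ be the least $n\ge1$ such that $K$ is covered by $n$ open sets of $d_M$-diameter at most $\varepsilon$. The upper and lower metric mean dimensions of $(X,T,d)$ are the $\limsup$ and the $\liminf$, as $\varepsilon\to0$, of $\lim_{M\to\infty}\frac{\log N_{d_M}(X,\varepsilon)}{M\log(1/\varepsilon)}$; if they agree, the common value is the metric mean dimension $\mathrm{mdim}_M$. For $0<\rho<r$ put $S(r,\rho)=\lim_{M\to\infty}\frac1M\sup_{x\in X}\log N_{d_M}(B_{d_M}(x,r),\rho)$. (The limits over $M$ exist by subadditivity.) The mean Assouad dimension and, for $\theta\in(0,1)$, the mean Assouad spectrum are $$\mathrm{mdim}_A=\inf\{s>0:\ \exists C>0\ \forall\, 0<\rho<r:\ e^{S(r,\rho)}\le C(r/\rho)^s\},$$ $$\mathrm{mdim}_A^\theta=\inf\{s>0:\ \exists C>0\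 \forall\, 0<r<1:\ e^{S(r,r^{1/\theta})}\le C(r/r^{1/\theta})^s\}.$$ Let $a>b\ge2$ be integers, $A=\{0,\dots,a-1\}$, $B=\{0,\dots,b-1\}$, and let $\Omega\subset(A\times B)^{\mathbb N}$ be a non-empty closed set which the shift maps into itself. The Bedford--McMullen carpet system $(X_\Omega,\sigma,d)$ is the set $$X_\Omega=\Bigl\{\Bigl(\sum_{m\ge1}\frac{x_m}{a^m},\ \sum_{m\ge1}\frac{y_m}{b^m}\Bigr)\in[0,1]^{\mathbb N}\times[0,1]^{\mathbb N}:\ (x_m,y_m)\in\Omega\ \text{for all } m\ge1\Bigr\}$$ (the sums are taken coordinatewise) with the shift $\sigma((x_n)_n,(y_n)_n)=((x_{n+1})_n,(y_{n+1})_n)$ and the metric $d((x,y),(x',y'))=\sum_{n\ge1}2^{-n}\max\{|x_n-x_n'|,|y_n-y_n'|\}$. **Statement.** For every Bedford--McMullen carpet system $(X_\Omega,\sigma,d)$ with parameters $a>b\ge 2$ the metric mean dimension $\mathrm{mdim}_M$ exists, $\mathrm{mdim}_M$ and $\mathrm{mdim}_A$ are finite, and $$\mathrm{mdim}_A^\theta=\frac{\mathrm{mdim}_M-\theta\Bigl(\mathrm{mdim}_A-(\mathrm{mdim}_A-\mathrm{mdim}_M)\frac{\log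 a}{\log b}\Bigr)}{1-\theta}\quad\text{if } 0<\theta\le\frac{\log b}{\log a},$$ $$\mathrm{mdim}_A^\theta=\mathrm{mdim}_A\quad\text{if }\frac{\log b}{\log a}<\theta<1.$$ In particular the spectrum is determined by $\log b/\log a$, $\mathrm{mdim}_M$ and $\mathrm{mdim}_A$: two carpet systems for which these three numbers agree have the same mean Assouad spectrum on $(0,1)$. Moreover, $\log b/\log a$ is a bi-Lipschitz invariant of carpet systems with $\mathrm{mdim}_M\ne\mathrm{mdim}_A$: if two carpet systems, with parameters $(a,b)$ and $(a',b')$, are related by a bi-Lipschitz bijection that commutes with the shifts, and the first has $\mathrm{mdim}_M\neq\mathrm{mdim}_A$, then $\log b/\log a=\log b'/\log a'$. -/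

import Mathlib

open Filter Topology Set

noncomputable section

namespace MeanAssouad

/-! ### Covering numbers and mean dimensions of a dynamical system `(X, T, d)` -/

section General

variable {X : Type*} [MetricSpace X]

/-- The Bowen metric `d_M(x, y) = max_{0 ≤ m < M} d(T^m x, T^m y)`. -/
def bowenDist (T : X → X) (M : ℕ) (x y : X) : ℝ :=
  ⨆ m : Fin M, dist (T^[m] x) (T^[m] y)

/-- The closed Bowen ball `B_{d_M}(x, r) = {y | d_M(x, y) ≤ r}`. -/
def bowenBall (T : X → X) (M : ℕ) (x : X) (r : ℝ) : Set X :=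
  {y | bowenDist T M x y ≤ r}

/-- The covering number `N_{d_M}(K, ε)`: the least `n ≥ 1` such that `K` is covered by `n` open
sets, each of `d_M`-diameter at most `ε` (and `⊤` if there is no such `n`). -/
def coverNum (T : X → X) (M : ℕ) (K : Set X) (ε : ℝ) : ℕ∞ :=
  ⨅ (n : ℕ) (_ : 1 ≤ n ∧ ∃ U : Fin n → Set X, (∀ i, IsOpen (U i)) ∧ K ⊆ ⋃ i, U i ∧
    ∀ i, ∀ y ∈ U i, ∀ z ∈ U i, bowenDist T M y z ≤ ε), (n : ℕ∞)

/-- `log N_{d_M}(K, ε)`, as an extended real number. -/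
def logCoverNum (T : X → X) (M : ℕ) (K : Set X) (ε : ℝ) : EReal :=
  ENNReal.log (coverNum T M K ε : ENNReal)

/-- The upper metric mean dimension
`limsup_{ε → 0} lim_{M → ∞} log N_{d_M}(X, ε) / (M log (1/ε))`. The inner limit exists by
subadditivity in `M`, so that it is the upper limit written here. -/
def upperMetricMeanDim (T : X → X) : EReal :=
  limsup (fun ε : ℝ => limsup (fun M : ℕ =>
    logCoverNum T M univ ε / ((M * Real.log (1 / ε) : ℝ) : EReal)) atTop) (𝓝[>] 0)

/-- The lower metric mean dimension
`liminf_{ε → 0} lim_{M → ∞} log N_{d_M}(X, ε) / (M log (1/ε))`. -/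
def lowerMetricMeanDim (T : X → X) : EReal :=
  liminf (fun ε : ℝ => limsup (fun M : ℕ =>
    logCoverNum T M univ ε / ((M * Real.log (1 / ε) : ℝ) : EReal)) atTop) (𝓝[>] 0)

/-- `S(X, r, ρ) = lim_{M → ∞} (1/M) sup_{x ∈ X} log N_{d_M}(B_{d_M}(x, r), ρ)`. The limit exists by
subadditivity in `M`, so that it is the upper limit written here. -/
def localGrowth (T : X → X) (r ρ : ℝ) : EReal :=
  limsup (fun M : ℕ => (⨆ x : X, logCoverNum T M (bowenBall T M x r) ρ) / ((M : ℝ) : EReal)) atTop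

/-- The mean Assouad dimension: the infimum (in `[0, ∞]`) of all `s > 0` for which there is `C > 0`
with `exp S(X, r, ρ) ≤ C (r/ρ)^s` for all `0 < ρ < r`. -/
def meanAssouadDim (T : X → X) : EReal :=
  ⨅ (s : ℝ) (_ : 0 < s ∧ ∃ C : ℝ, 0 < C ∧ ∀ r ρ : ℝ, 0 < ρ → ρ < r →
    EReal.exp (localGrowth T r ρ) ≤ ENNReal.ofReal (C * (r / ρ) ^ s)), (s : EReal)

/-- The mean Assouad spectrum at `θ ∈ (0, 1)`: the infimum (in `[0, ∞]`) of all `s > 0` for which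
there is `C > 0` with `exp S(X, r, r^{1/θ}) ≤ C (r / r^{1/θ})^s` for all `0 < r < 1`. -/
def meanAssouadSpectrum (T : X → X) (θ : ℝ) : EReal :=
  ⨅ (s : ℝ) (_ : 0 < s ∧ ∃ C : ℝ, 0 < C ∧ ∀ r : ℝ, 0 < r → r < 1 →
    EReal.exp (localGrowth T r (r ^ (1 / θ))) ≤ ENNReal.ofReal (C * (r / r ^ (1 / θ)) ^ s)),
    (s : EReal)

/-- `(X, T)` and `(Y, S)` are bi-Lipschitz isomorphic: some bi-Lipschitz bijection `Φ : X → Y`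
satisfies `Φ ∘ T = S ∘ Φ`. -/
def BiLipschitzIsomorphic {Y : Type*} [MetricSpace Y] (T : X → X) (S : Y → Y) : Prop :=
  ∃ Φ : X ≃ Y, (∃ L : ℝ, 1 < L ∧ ∀ x x' : X,
    L⁻¹ * dist x x' ≤ dist (Φ x) (Φ x') ∧ dist (Φ x) (Φ x') ≤ L * dist x x') ∧
    ∀ x, Φ (T x) = S (Φ x)

end General

/-! ### The ambient space `[0,1]^ℕ × [0,1]^ℕ` -/

/-- Points of `[0,1]^ℕ × [0,1]^ℕ` (coordinates are indexed from `0`). -/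
@[ext]
structure CubePair where
  x : ℕ → Icc (0 : ℝ) 1
  y : ℕ → Icc (0 : ℝ) 1

namespace CubePair

/-- The `n`-th term of the series defining the metric, with `n` counted from `0`. -/
def distTerm (p q : CubePair) (n : ℕ) : ℝ :=
  (1 / 2 : ℝ) ^ (n + 1) * max |(p.x n : ℝ) - q.x n| |(p.y n : ℝ) - q.y n|

lemma distTerm_nonneg (p q : CubePair) (n : ℕ) : 0 ≤ distTerm p q n := by
  unfold distTerm
  positivity

lemma abs_sub_le_one (u v : Icc (0 : ℝ) 1) : |(u : ℝ) - v| ≤ 1 := by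
  have hu := u.2
  have hv := v.2
  rw [abs_le]
  constructor <;> linarith [hu.1, hu.2, hv.1, hv.2]

lemma summable_distTerm (p q : CubePair) : Summable (distTerm p q) := by
  have h : Summable fun n : ℕ => (1 / 2 : ℝ) ^ (n + 1) :=
    (summable_nat_add_iff 1).2 summable_geometric_two
  refine Summable.of_nonneg_of_le (distTerm_nonneg p q) (fun n => ?_) h
  have h1 : max |(p.x n : ℝ) - q.x n| |(p.y n : ℝ) - q.y n| ≤ 1 :=
    max_le (abs_sub_le_one _ _) (abs_sub_le_one _ _)
  have h2 : (0 : ℝ) ≤ (1 / 2 : ℝ) ^ (n + 1) := by positivity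
  unfold distTerm
  nlinarith

lemma distTerm_triangle (p q s : CubePair) (n : ℕ) :
    distTerm p s n ≤ distTerm p q n + distTerm q s n := by
  unfold distTerm
  rw [← mul_add]
  refine mul_le_mul_of_nonneg_left (max_le ?_ ?_) (by positivity)
  · exact (abs_sub_le _ (q.x n : ℝ) _).trans (add_le_add (le_max_left _ _) (le_max_left _ _))
  · exact (abs_sub_le _ (q.y n : ℝ) _).trans (add_le_add (le_max_right _ _) (le_max_right _ _))

/-- The metric `d((x,y),(x',y')) = ∑_{n ≥ 1} 2^{-n} max {|x_n - x'_n|, |y_n - y'_n|}`. -/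
instance : MetricSpace CubePair where
  dist p q := ∑' n, distTerm p q n
  dist_self p := by simp [distTerm]
  dist_comm p q := by
    refine tsum_congr fun n => ?_
    simp only [distTerm]
    rw [abs_sub_comm (p.x n : ℝ), abs_sub_comm (p.y n : ℝ)]
  dist_triangle p q s := by
    rw [← (summable_distTerm p q).tsum_add (summable_distTerm q s)]
    exact (summable_distTerm p s).tsum_le_tsum (distTerm_triangle p q s)
      ((summable_distTerm p q).add (summable_distTerm q s))
  eq_of_dist_eq_zero := by
    intro p q h
    have h0 : ∀ n, distTerm p q n = 0 := fun n =>
      congrFun (((summable_distTerm p q).hasSum_iff.2 h |>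
        (hasSum_zero_iff_of_nonneg (distTerm_nonneg p q)).1)) n
    have hm : ∀ n, max |(p.x n : ℝ) - q.x n| |(p.y n : ℝ) - q.y n| = 0 := fun n =>
      (mul_eq_zero.1 (h0 n)).resolve_left (by positivity)
    ext n
    · have h1 := (le_max_left _ _).trans (hm n).le
      exact sub_eq_zero.1 (abs_nonpos_iff.1 h1)
    · have h1 := (le_max_right _ _).trans (hm n).le
      exact sub_eq_zero.1 (abs_nonpos_iff.1 h1)

/-- The shift `((x_n)_n, (y_n)_n) ↦ ((x_{n+1})_n, (y_{n+1})_n)`. -/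
def shift (p : CubePair) : CubePair where
  x n := p.x (n + 1)
  y n := p.y (n + 1)

end CubePair

/-! ### Bedford--McMullen carpet systems -/

/-- The data of a Bedford--McMullen carpet system: integers `a > b ≥ 2` and a non-empty subshift
`Ω ⊆ (A × B)^ℕ`, where `A = {0, …, a-1}` and `B = {0, …, b-1}`. -/
structure CarpetData where
  a : ℕ
  b : ℕ
  two_le_b : 2 ≤ b
  b_lt_a : b < a
  Ω : Set (ℕ → Fin a × Fin b)
  nonempty : Ω.Nonempty
  isClosed : IsClosed Ω
  shift_mem : ∀ ω ∈ Ω, (fun n => ω (n + 1)) ∈ Ω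

namespace CarpetData

/-- The set `X_Ω` of all points `(∑_{m ≥ 1} x_m / a^m, ∑_{m ≥ 1} y_m / b^m)` with `(x_m, y_m) ∈ Ω`
for every `m ≥ 1`. Here `ω m` is the digit sequence `(x_{m+1}, y_{m+1})`, and the sums are taken
coordinate by coordinate. -/
def carpet (D : CarpetData) : Set CubePair :=
  {p | ∃ ω : ℕ → ℕ → Fin D.a × Fin D.b, (∀ m, ω m ∈ D.Ω) ∧ ∀ n,
    (p.x n : ℝ) = ∑' m : ℕ, (((ω m n).1 : ℕ) : ℝ) / (D.a : ℝ) ^ (m + 1) ∧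
    (p.y n : ℝ) = ∑' m : ℕ, (((ω m n).2 : ℕ) : ℝ) / (D.b : ℝ) ^ (m + 1)}

lemma mapsTo_shift (D : CarpetData) : MapsTo CubePair.shift D.carpet D.carpet := by
  rintro p ⟨ω, hω, hp⟩
  exact ⟨fun m n => ω m (n + 1), fun m => D.shift_mem _ (hω m), fun n => hp (n + 1)⟩

/-- The shift map of the carpet system `(X_Ω, σ, d)`; `X_Ω` carries the restriction of `d`. -/
def σ (D : CarpetData) : D.carpet → D.carpet :=
  D.mapsTo_shift.restrict CubePair.shift D.carpet D.carpet

/-- The ratio `log b / log a`. -/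
def ratio (D : CarpetData) : ℝ :=
  Real.log D.b / Real.log D.a

end CarpetData

end MeanAssouad

end

noncomputable section

namespace MeanAssouad

/-! ### Counting words in the fibres of a subshift -/

section Counting

/-! Write `r = exp (-u)`, `ρ = exp (-v)` and `κ = log b / log a`. At one time, knowing a point to
precision `r` means, up to boundedly many neighbouring cells, knowing its x-digits of level below `u
/ log a` and its y-digits of level below `u / log b`. The levels of an array run through `Ω`
independently. Covering an `r`-ball by sets of size `ρ` therefore amounts to counting, level by
level, the words of digits needed for `ρ` over one word of digits known from `r`. The worst known
words of the different levels can be realised by one array, so the product bound is sharp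
(`ncard_pattern_fiber_le`, `exists_le_ncard_pattern_fiber`).

Per unit of time a level contributes `entropyX` (y known, x wanted), `entropy` (nothing known, both
wanted), `entropyY` (nothing known, only y wanted) or nothing (`fiberEntropy_mask`). Neighbouring
cells cost a factor 49 per time, and the tail of the metric costs a factor independent of `M`.
Summing over levels gives `localGrowth` equal to `profile κ A M u v` with an error bounded uniformly
in `u` and `v` (`localGrowth_le_profile`, `profile_le_localGrowth`). As a function of `v` the
profile has slope `A` until `v = u / κ`, where the wanted x-levels overtake the known y-levels, and
slope `M` afterwards.

Everything else is read off the profile, which is homogeneous of degree one, so bounded errors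
disappear at small scales. The value at `u = 0` gives `mdim_M`, the steepest slope gives `mdim_A`,
and `profile 1 (1/θ) / (1/θ - 1)` is the spectrum. A bi-Lipschitz conjugacy moves `u` and `v` by a
constant, so it preserves the profile, and the kink at `1 / κ` is visible when `A ≠ M`. -/

lemma ncard_image_le_of_factor {α β γ : Type*} [Finite γ] (f : α → β) (g : α → γ) (Z : Set α)
    (h : ∀ x ∈ Z, ∀ y ∈ Z, g x = g y → f x = f y) : (f '' Z).ncard ≤ (g '' Z).ncard := by
  classical
  rcases Z.eq_empty_or_nonempty with rfl | ⟨z, hz⟩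
  · simp
  have : Nonempty α := ⟨z⟩
  have hsub : f '' Z ⊆ (fun c => f (Function.invFunOn g Z c)) '' (g '' Z) := by
    rintro _ ⟨x, hx, rfl⟩
    have hex : ∃ a ∈ Z, g a = g x := ⟨x, hx, rfl⟩
    exact ⟨g x, ⟨x, hx, rfl⟩,
      h _ (Function.invFunOn_mem hex) _ hx (Function.invFunOn_eq hex)⟩
  exact (ncard_le_ncard hsub ((toFinite _).image _)).trans (ncard_image_le (toFinite _))

lemma ncard_image_le_mul {α β γ : Type*} [Finite β] [Finite γ] (f : α → β) (g : α → γ) (Z : Set α)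
    (N : ℕ) (h : ∀ c, (f '' {x | x ∈ Z ∧ g x = c}).ncard ≤ N) :
    (f '' Z).ncard ≤ (g '' Z).ncard * N := by
  classical
  have hfin : (g '' Z).Finite := toFinite _
  have hsub : f '' Z ⊆ ⋃ c ∈ hfin.toFinset, f '' {x | x ∈ Z ∧ g x = c} := by
    rintro _ ⟨x, hx, rfl⟩
    simp only [mem_iUnion]
    exact ⟨g x, hfin.mem_toFinset.2 ⟨x, hx, rfl⟩, x, ⟨hx, rfl⟩, rfl⟩
  refine (ncard_le_ncard hsub (toFinite _)).trans ?_
  refine (Finset.set_ncard_biUnion_le _ _).trans ?_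
  refine (Finset.sum_le_card_nsmul _ _ N fun c _ => h c).trans ?_
  rw [ncard_eq_toFinset_card _ hfin, smul_eq_mul]

lemma ncard_univ_pi {ι β : Type*} [Fintype ι] [Finite β] (A : ι → Set β) :
    (Set.pi univ A).ncard = ∏ i, (A i).ncard := by
  classical
  have h : (Set.pi univ A) = ↑(Fintype.piFinset fun i => (toFinite (A i)).toFinset) := by
    ext x
    simp
  rw [h, ncard_coe_finset, Fintype.card_piFinset]
  exact Finset.prod_congr rfl fun i _ => (ncard_eq_toFinset_card _ _).symm

variable {S C : Type*} [Fintype C]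

/-- The `T`-words of length `W` of sequences in `Ω` whose `K`-word is `κ`. -/
def fiberWords (Ω : Set (ℕ → S)) (K T : S → C) (W : ℕ) (κ : Fin W → C) : Set (Fin W → C) :=
  (fun ω (n : Fin W) => T (ω n)) '' {ω | ω ∈ Ω ∧ (fun n : Fin W => K (ω n)) = κ}

open Classical in
/-- The largest number of `T`-words of length `W` over one `K`-word. -/
def fiberCount (Ω : Set (ℕ → S)) (K T : S → C) (W : ℕ) : ℕ :=
  Finset.univ.sup fun κ : Fin W → C => (fiberWords Ω K T W κ).ncard

lemma ncard_fiberWords_le (Ω : Set (ℕ → S)) (K T : S → C) (W : ℕ) (κ : Fin W → C) :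
    (fiberWords Ω K T W κ).ncard ≤ fiberCount Ω K T W := by
  classical
  exact Finset.le_sup (f := fun κ : Fin W → C => (fiberWords Ω K T W κ).ncard)
    (Finset.mem_univ κ)

lemma fiberCount_le {Ω : Set (ℕ → S)} {K T : S → C} {W N : ℕ}
    (h : ∀ κ, (fiberWords Ω K T W κ).ncard ≤ N) : fiberCount Ω K T W ≤ N := by
  classical
  exact Finset.sup_le fun κ _ => h κ

lemma exists_ncard_fiberWords_eq {Ω : Set (ℕ → S)} (hΩ : Ω.Nonempty) (K T : S → C) (W : ℕ) :
    ∃ κ, (fiberWords Ω K T W κ).ncard = fiberCount Ω K T W := by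
  classical
  obtain ⟨ω, -⟩ := hΩ
  obtain ⟨κ, -, h⟩ := Finset.exists_mem_eq_sup (Finset.univ : Finset (Fin W → C))
    ⟨fun n => K (ω n), Finset.mem_univ _⟩ fun κ => (fiberWords Ω K T W κ).ncard
  exact ⟨κ, h.symm⟩

lemma fiberCount_pos {Ω : Set (ℕ → S)} (hΩ : Ω.Nonempty) (K T : S → C) (W : ℕ) :
    0 < fiberCount Ω K T W := by
  obtain ⟨ω, hω⟩ := hΩ
  refine lt_of_lt_of_le ?_ (ncard_fiberWords_le Ω K T W fun n => K (ω n))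
  rw [ncard_pos]
  exact ⟨_, ω, ⟨hω, rfl⟩, rfl⟩

/-- Cutting a word at time `V` leaves two words over the two pieces of `κ`; the second piece comes
from a shifted sequence, which stays in `Ω`. -/
lemma fiberCount_add_le {Ω : Set (ℕ → S)} (hs : ∀ ω ∈ Ω, (fun n => ω (n + 1)) ∈ Ω)
    (K T : S → C) (V W : ℕ) :
    fiberCount Ω K T (V + W) ≤ fiberCount Ω K T V * fiberCount Ω K T W := by
  have hs' : ∀ k : ℕ, ∀ ω ∈ Ω, (fun n => ω (k + n)) ∈ Ω := by
    intro k
    induction k with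
    | zero => intro ω hω; simpa using hω
    | succ k ih =>
      intro ω hω
      have := ih _ (hs ω hω)
      simpa [add_right_comm] using this
  refine fiberCount_le fun κ => ?_
  have hsub : (fun t : Fin (V + W) → C => ((fun i => t (Fin.castAdd W i), fun i => t (Fin.natAdd V i)) :
      (Fin V → C) × (Fin W → C))) '' (fiberWords Ω K T (V + W) κ) ⊆
      (fiberWords Ω K T V fun i => κ (Fin.castAdd W i)) ×ˢ
      (fiberWords Ω K T W fun i => κ (Fin.natAdd V i)) := by
    rintro _ ⟨_, ⟨ω, ⟨hω, hκ⟩, rfl⟩, rfl⟩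
    subst hκ
    refine ⟨⟨ω, ⟨hω, ?_⟩, ?_⟩, ⟨_, ⟨hs' V ω hω, ?_⟩, ?_⟩⟩ <;> simp
  have hinj : Function.Injective (fun t : Fin (V + W) → C =>
      ((fun i => t (Fin.castAdd W i), fun i => t (Fin.natAdd V i)) :
      (Fin V → C) × (Fin W → C))) := by
    intro t t' h
    rw [Prod.mk.injEq] at h
    ext i
    induction i using Fin.addCases with
    | left i => exact congrFun h.1 i
    | right i => exact congrFun h.2 i
  rw [← ncard_image_of_injective _ hinj]
  refine (ncard_le_ncard hsub (toFinite _)).trans ?_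
  rw [ncard_prod]
  exact Nat.mul_le_mul (ncard_fiberWords_le _ _ _ _ _) (ncard_fiberWords_le _ _ _ _ _)

/-- Chain rule: reveal the `L`-word first, then the `T`-word over it. For entropies this becomes
`entropy_le`, hence `mdim_M ≤ mdim_A`. -/
lemma fiberCount_le_mul (Ω : Set (ℕ → S)) (K L T : S → C) (W : ℕ) :
    fiberCount Ω K T W ≤ fiberCount Ω K L W * fiberCount Ω L T W := by
  refine fiberCount_le fun κ => ?_
  refine (ncard_image_le_mul _ (fun ω (n : Fin W) => L (ω n)) _ (fiberCount Ω L T W)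
    fun c => ?_).trans (Nat.mul_le_mul_right _ ?_)
  swap
  · exact ncard_fiberWords_le Ω K L W κ
  refine (ncard_le_ncard (image_mono ?_) (toFinite _)).trans (ncard_fiberWords_le Ω L T W c)
  rintro ω ⟨⟨hω, -⟩, hc⟩
  exact ⟨hω, hc⟩

lemma fiberCount_le_one (Ω : Set (ℕ → S)) {K T : S → C} (h : ∀ s s', K s = K s' → T s = T s')
    (W : ℕ) : fiberCount Ω K T W ≤ 1 := by
  refine fiberCount_le fun κ => ?_
  rw [ncard_le_one_iff]
  rintro _ _ ⟨ω, ⟨-, hω⟩, rfl⟩ ⟨ω', ⟨-, hω'⟩, rfl⟩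
  ext n
  exact h _ _ (congrFun (hω.trans hω'.symm) n)

/-- The exponential growth rate of `fiberCount`. -/
def fiberEntropy (Ω : Set (ℕ → S)) (K T : S → C) : ℝ :=
  limUnder atTop fun n : ℕ => Real.log (fiberCount Ω K T n) / n

variable {Ω : Set (ℕ → S)}

lemma log_fiberCount_nonneg (K T : S → C) (W : ℕ) :
    0 ≤ Real.log (fiberCount Ω K T W) := Real.log_natCast_nonneg _

lemma bddBelow_log_fiberCount_div (K T : S → C) :
    BddBelow (range fun n : ℕ => Real.log (fiberCount Ω K T n) / n) := by
  refine ⟨0, ?_⟩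
  rintro _ ⟨n, rfl⟩
  exact div_nonneg (log_fiberCount_nonneg K T n) n.cast_nonneg

lemma subadditive_log_fiberCount (hΩ : Ω.Nonempty) (hs : ∀ ω ∈ Ω, (fun n => ω (n + 1)) ∈ Ω)
    (K T : S → C) : Subadditive fun n => Real.log (fiberCount Ω K T n) := by
  intro m n
  have h : ∀ n, (fiberCount Ω K T n : ℝ) ≠ 0 := fun n =>
    Nat.cast_ne_zero.2 (fiberCount_pos hΩ K T n).ne'
  rw [← Real.log_mul (h m) (h n)]
  refine Real.log_le_log (Nat.cast_pos.2 (fiberCount_pos hΩ K T _)) ?_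
  exact_mod_cast fiberCount_add_le hs K T m n

lemma fiberEntropy_eq_lim (hΩ : Ω.Nonempty) (hs : ∀ ω ∈ Ω, (fun n => ω (n + 1)) ∈ Ω)
    (K T : S → C) : fiberEntropy Ω K T = (subadditive_log_fiberCount hΩ hs K T).lim :=
  ((subadditive_log_fiberCount hΩ hs K T).tendsto_lim
    (bddBelow_log_fiberCount_div K T)).limUnder_eq

lemma tendsto_fiberEntropy (hΩ : Ω.Nonempty) (hs : ∀ ω ∈ Ω, (fun n => ω (n + 1)) ∈ Ω)
    (K T : S → C) :
    Tendsto (fun n : ℕ => Real.log (fiberCount Ω K T n) / n) atTop (𝓝 (fiberEntropy Ω K T)) :=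
  fiberEntropy_eq_lim hΩ hs K T ▸ (subadditive_log_fiberCount hΩ hs K T).tendsto_lim (bddBelow_log_fiberCount_div K T)

lemma mul_fiberEntropy_le (hΩ : Ω.Nonempty) (hs : ∀ ω ∈ Ω, (fun n => ω (n + 1)) ∈ Ω)
    (K T : S → C) (W : ℕ) : W * fiberEntropy Ω K T ≤ Real.log (fiberCount Ω K T W) := by
  rcases Nat.eq_zero_or_pos W with rfl | hW
  · simpa using log_fiberCount_nonneg K T 0
  · have h := (subadditive_log_fiberCount hΩ hs K T).lim_le_div
      (bddBelow_log_fiberCount_div K T) hW.ne'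
    rw [← fiberEntropy_eq_lim hΩ hs, le_div_iff₀ (Nat.cast_pos.2 hW)] at h
    linarith

lemma fiberEntropy_nonneg (hΩ : Ω.Nonempty) (hs : ∀ ω ∈ Ω, (fun n => ω (n + 1)) ∈ Ω)
    (K T : S → C) : 0 ≤ fiberEntropy Ω K T :=
  ge_of_tendsto' (tendsto_fiberEntropy hΩ hs K T) fun n =>
    div_nonneg (log_fiberCount_nonneg K T n) n.cast_nonneg

lemma fiberEntropy_le_add (hΩ : Ω.Nonempty) (hs : ∀ ω ∈ Ω, (fun n => ω (n + 1)) ∈ Ω)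
    (K L T : S → C) :
    fiberEntropy Ω K T ≤ fiberEntropy Ω K L + fiberEntropy Ω L T := by
  refine le_of_tendsto_of_tendsto' (tendsto_fiberEntropy hΩ hs K T)
    ((tendsto_fiberEntropy hΩ hs K L).add (tendsto_fiberEntropy hΩ hs L T)) fun n => ?_
  rw [← add_div, ← Real.log_mul (Nat.cast_ne_zero.2 (fiberCount_pos hΩ K L n).ne')
    (Nat.cast_ne_zero.2 (fiberCount_pos hΩ L T n).ne')]
  refine div_le_div_of_nonneg_right (Real.log_le_log
    (Nat.cast_pos.2 (fiberCount_pos hΩ K T _)) ?_) n.cast_nonneg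
  exact_mod_cast fiberCount_le_mul Ω K L T n

lemma fiberEntropy_eq_zero (hΩ : Ω.Nonempty) (hs : ∀ ω ∈ Ω, (fun n => ω (n + 1)) ∈ Ω)
    {K T : S → C} (h : ∀ s s', K s = K s' → T s = T s') : fiberEntropy Ω K T = 0 := by
  refine le_antisymm ?_ (fiberEntropy_nonneg hΩ hs _ _)
  -- The rate is an infimum over word lengths, so length 1 already bounds it.
  have h1 := mul_fiberEntropy_le hΩ hs K T 1
  have h2 : fiberCount Ω K T 1 = 1 :=
    le_antisymm (fiberCount_le_one Ω h 1) (fiberCount_pos hΩ K T 1)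
  simpa [h2] using h1

/-- The arrays all of whose levels are in `Ω`. -/
def arrays (Ω : Set (ℕ → S)) : Set (ℕ → ℕ → S) := {ω | ∀ m, ω m ∈ Ω}

/-- What the maps `K m` see of the first `J` levels of an array at the first `W` times. -/
def pattern (K : ℕ → S → C) (J W : ℕ) (ω : ℕ → ℕ → S) : Fin J → Fin W → C :=
  fun m n => K m (ω m n)

lemma ncard_pattern_fiber_le (Ω : Set (ℕ → S)) (K T : ℕ → S → C) (J W : ℕ)
    (κ : Fin J → Fin W → C) :
    (pattern T J W '' {ω | ω ∈ arrays Ω ∧ pattern K J W ω = κ}).ncard ≤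
      ∏ m : Fin J, fiberCount Ω (K m) (T m) W := by
  have hsub : pattern T J W '' {ω | ω ∈ arrays Ω ∧ pattern K J W ω = κ} ⊆
      Set.pi univ fun m : Fin J => fiberWords Ω (K m) (T m) W (κ m) := by
    rintro _ ⟨ω, ⟨hω, rfl⟩, rfl⟩ m -
    exact ⟨ω m, ⟨hω m, rfl⟩, rfl⟩
  refine (ncard_le_ncard hsub (toFinite _)).trans ?_
  rw [ncard_univ_pi]
  exact Finset.prod_le_prod' fun m _ => ncard_fiberWords_le _ _ _ _ _

/-- A worst word `κ m` is chosen separately at each level. Levels are unrelated, so any choice of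
sequences over the `κ m` glues to an array; levels from `J` on get a default element of `Ω`. -/
lemma exists_le_ncard_pattern_fiber (hΩ : Ω.Nonempty) (K T : ℕ → S → C) (J W : ℕ) :
    ∃ κ : Fin J → Fin W → C, ∏ m : Fin J, fiberCount Ω (K m) (T m) W ≤
      (pattern T J W '' {ω | ω ∈ arrays Ω ∧ pattern K J W ω = κ}).ncard := by
  classical
  choose κ hκ using fun m : Fin J => exists_ncard_fiberWords_eq hΩ (K m) (T m) W
  obtain ⟨ω₀, hω₀⟩ := hΩ
  refine ⟨κ, ?_⟩
  simp_rw [← hκ]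
  rw [← ncard_univ_pi]
  refine ncard_le_ncard ?_ (toFinite _)
  intro t ht
  choose ω hω hT using fun m : Fin J => ht m (mem_univ m)
  refine ⟨fun m => if h : m < J then ω ⟨m, h⟩ else ω₀, ⟨fun m => ?_, ?_⟩, ?_⟩
  · by_cases h : m < J
    · simpa [h] using (hω ⟨m, h⟩).1
    · simpa [h] using hω₀
  · ext m n
    have := congrFun (hω m).2 n
    simpa [pattern] using this
  · ext m n
    have := congrFun (hT m) n
    simpa [pattern] using this

/-- Lengthening the time window by `N` costs a factor independent of `M`, hence nothing for the
growth rate. -/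
lemma ncard_pattern_add_le (T : ℕ → S → C) (J M N : ℕ) (Z : Set (ℕ → ℕ → S)) :
    (pattern T J (M + N) '' Z).ncard ≤
      (pattern T J M '' Z).ncard * Fintype.card C ^ (J * N) := by
  classical
  refine ncard_image_le_mul _ (pattern T J M) Z _ fun c => ?_
  refine (ncard_image_le_of_factor _
    (fun ω (p : Fin J × Fin N) => T p.1 (ω p.1 (M + p.2))) _ ?_).trans ?_
  · rintro ω ⟨-, hω⟩ ω' ⟨-, hω'⟩ h
    ext m n
    induction n using Fin.addCases with
    | left n => exact congrFun (congrFun (hω.trans hω'.symm) m) n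
    | right n => exact congrFun h (m, n)
  · refine (ncard_le_card _).trans ?_
    simp [Nat.card_eq_fintype_card]

end Counting

/-! ### Digits -/

section Digits

/-- The integer with the first `k` digits of `s`. -/
def digitNat {b : ℕ} (s : ℕ → Fin b) : ℕ → ℕ
  | 0 => 0
  | k + 1 => b * digitNat s k + s k

lemma eq_of_digitNat_eq {b : ℕ} {s s' : ℕ → Fin b} {k : ℕ} (h : digitNat s k = digitNat s' k) :
    ∀ i < k, s i = s' i := by
  induction k with
  | zero => intro i hi; omega
  | succ k ih =>
    simp only [digitNat] at h
    have h1 : (s k : ℕ) = s' k := by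
      have := congrArg (· % b) h
      simpa [Nat.mul_add_mod, Nat.mod_eq_of_lt] using this
    have hb : 0 < b := Fin.pos (s 0)
    have h2 : digitNat s k = digitNat s' k := by
      rw [h1] at h
      exact Nat.eq_of_mul_eq_mul_left hb (Nat.add_right_cancel h)
    intro i hi
    rcases Nat.lt_succ_iff_lt_or_eq.1 hi with hi | rfl
    · exact ih h2 i hi
    · exact Fin.ext h1

lemma pow_mul_ofDigits {b : ℕ} (s : ℕ → Fin b) (k : ℕ) :
    (b : ℝ) ^ k * Real.ofDigits s = digitNat s k + Real.ofDigits fun i => s (i + k) := by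
  have hb : (b : ℝ) ≠ 0 := Nat.cast_ne_zero.2 (Fin.pos (s 0)).ne'
  induction k with
  | zero => simp [digitNat]
  | succ k ih =>
    rw [pow_succ', mul_assoc, ih, Real.ofDigits_eq_sum_add_ofDigits (fun i => s (i + k)) 1]
    simp only [digitNat, Finset.sum_range_one, Real.ofDigitsTerm]
    push_cast
    field_simp
    simp [add_assoc, add_comm 1 k]

/-- After scaling by `b ^ k` the points differ by at most 2, and their tails, both in `[0,1]`,
differ by at most 1. -/
lemma digitNat_close {b : ℕ} {s s' : ℕ → Fin b} {k : ℕ}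
    (h : |Real.ofDigits s - Real.ofDigits s'| ≤ 2 * ((b : ℝ) ^ k)⁻¹) :
    digitNat s k ≤ digitNat s' k + 3 ∧ digitNat s' k ≤ digitNat s k + 3 := by
  have hb : (0 : ℝ) < (b : ℝ) ^ k := pow_pos (Nat.cast_pos.2 (Fin.pos (s 0))) k
  have h1 : |(b : ℝ) ^ k * Real.ofDigits s - (b : ℝ) ^ k * Real.ofDigits s'| ≤ 2 := by
    rw [← mul_sub, abs_mul, abs_of_pos hb]
    refine (mul_le_mul_of_nonneg_left h hb.le).trans_eq ?_
    field_simp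
  rw [pow_mul_ofDigits, pow_mul_ofDigits, abs_le] at h1
  have h2 := Real.ofDigits_nonneg fun i => s (i + k)
  have h3 := Real.ofDigits_nonneg fun i => s' (i + k)
  have h4 := Real.ofDigits_le_one fun i => s (i + k)
  have h5 := Real.ofDigits_le_one fun i => s' (i + k)
  constructor
  · have : (digitNat s k : ℝ) ≤ digitNat s' k + 3 := by linarith [h1.2]
    exact_mod_cast this
  · have : (digitNat s' k : ℝ) ≤ digitNat s k + 3 := by linarith [h1.1]
    exact_mod_cast this

end Digits

/-! ### The metric of `[0,1]^ℕ × [0,1]^ℕ` -/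

namespace CubePair

lemma dist_def (p q : CubePair) : dist p q = ∑' n, distTerm p q n := rfl

lemma dist_eq_add (p q : CubePair) : dist p q =
    1 / 2 * max |(p.x 0 : ℝ) - q.x 0| |(p.y 0 : ℝ) - q.y 0| + 1 / 2 * dist p.shift q.shift := by
  rw [dist_def, (summable_distTerm p q).tsum_eq_zero_add, dist_def, ← tsum_mul_left]
  congr 1
  · simp [distTerm]
  · refine tsum_congr fun n => ?_
    simp only [distTerm, shift]
    ring

lemma dist_le_one (p q : CubePair) : dist p q ≤ 1 := by
  have h : HasSum (fun n : ℕ => (1 / 2 : ℝ) ^ (n + 1)) 1 := by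
    have := hasSum_geometric_two.mul_left (1 / 2 : ℝ)
    simpa [pow_succ'] using this
  rw [dist_def, ← h.tsum_eq]
  refine (summable_distTerm p q).tsum_le_tsum (fun n => ?_) h.summable
  exact mul_le_of_le_one_right (by positivity) (max_le (abs_sub_le_one _ _) (abs_sub_le_one _ _))

lemma max_le_two_mul_dist (p q : CubePair) :
    max |(p.x 0 : ℝ) - q.x 0| |(p.y 0 : ℝ) - q.y 0| ≤ 2 * dist p q := by
  have := dist_eq_add p q
  have := dist_nonneg (x := p.shift) (y := q.shift)
  linarith

lemma dist_shift_le (p q : CubePair) : dist p.shift q.shift ≤ 2 * dist p q := by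
  have := dist_eq_add p q
  have : 0 ≤ max |(p.x 0 : ℝ) - q.x 0| |(p.y 0 : ℝ) - q.y 0| :=
    (abs_nonneg _).trans (le_max_left _ _)
  linarith

/-- The weights of the coordinates from `N` on sum to `2 ^ (-N)`. This is why Bowen distances up to
time `M` are controlled by coordinates up to `M + N`. -/
lemma dist_le_add_pow {δ : ℝ} (N : ℕ) (p q : CubePair)
    (h : ∀ n < N, |(p.x n : ℝ) - q.x n| ≤ δ ∧ |(p.y n : ℝ) - q.y n| ≤ δ) (hδ : 0 ≤ δ) :
    dist p q ≤ δ + (1 / 2) ^ N := by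
  induction N generalizing p q with
  | zero => simpa using (dist_le_one p q).trans (by linarith)
  | succ N ih =>
    have h0 := max_le (h 0 N.succ_pos).1 (h 0 N.succ_pos).2
    have h1 := ih p.shift q.shift fun n hn => h (n + 1) (by omega)
    rw [dist_eq_add, pow_succ]
    linarith

lemma shift_iterate_x (m n : ℕ) (p : CubePair) : (shift^[m] p).x n = p.x (m + n) := by
  induction m generalizing p with
  | zero => simp
  | succ m ih =>
    rw [Function.iterate_succ_apply, ih]
    simp [shift, add_right_comm]

lemma shift_iterate_y (m n : ℕ) (p : CubePair) : (shift^[m] p).y n = p.y (m + n) := by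
  induction m generalizing p with
  | zero => simp
  | succ m ih =>
    rw [Function.iterate_succ_apply, ih]
    simp [shift, add_right_comm]

end CubePair

/-! ### Bowen metrics and covering numbers -/

section Bowen

variable {X : Type*} [MetricSpace X] {T : X → X} {M : ℕ}

lemma dist_le_bowenDist (T : X → X) (M : ℕ) (x y : X) {m : ℕ} (hm : m < M) :
    dist (T^[m] x) (T^[m] y) ≤ bowenDist T M x y :=
  le_ciSup (f := fun m : Fin M => dist (T^[m] x) (T^[m] y)) (finite_range _).bddAbove ⟨m, hm⟩

lemma bowenDist_le {x y : X} {ε : ℝ} (hε : 0 ≤ ε)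
    (h : ∀ m < M, dist (T^[m] x) (T^[m] y) ≤ ε) : bowenDist T M x y ≤ ε :=
  Real.iSup_le (fun m => h m m.2) hε

lemma coverNum_le_of_factor {β : Type*} [Finite β] (hT : Continuous T) {K : Set X}
    (hK : K.Nonempty) (f : X → β) {δ ε : ℝ} (hδ : 0 < δ) (hε : 3 * δ ≤ ε)
    (h : ∀ q ∈ K, ∀ q' ∈ K, f q = f q' → bowenDist T M q q' ≤ δ) :
    coverNum T M K ε ≤ ((f '' K).ncard : ℕ∞) := by
  have hfin : (f '' K).Finite := toFinite _
  let e : Fin (f '' K).ncard ≃ (f '' K) := (Finite.equivFinOfCardEq rfl).symm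
  -- The open sets are the Bowen `δ`-neighbourhoods of the fibres of `f` on `K`; a path through two
  -- points of one fibre has length at most `3 * δ`.
  refine iInf₂_le (f '' K).ncard ⟨?_, fun i => {z | ∃ q ∈ K, f q = e i ∧
    ∀ m : Fin M, dist (T^[m] z) (T^[m] q) < δ}, fun i => ?_, fun q hq => ?_, ?_⟩
  · exact (ncard_pos hfin).2 (hK.image f)
  · have : {z | ∃ q ∈ K, f q = e i ∧ ∀ m : Fin M, dist (T^[m] z) (T^[m] q) < δ} =
        ⋃ q ∈ {q | q ∈ K ∧ f q = e i}, ⋂ m : Fin M, {z | dist (T^[m] z) (T^[m] q) < δ} := by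
      ext z
      simp [and_assoc]
    beta_reduce
    rw [this]
    exact isOpen_biUnion fun q _ => isOpen_iInter_of_finite fun m =>
      isOpen_lt ((hT.iterate m).dist continuous_const) continuous_const
  · rw [mem_iUnion]
    refine ⟨e.symm ⟨f q, q, hq, rfl⟩, q, hq, by simp, fun m => by simpa using hδ⟩
  · rintro i y ⟨q, hq, hqi, hy⟩ z ⟨q', hq', hqi', hz⟩
    refine bowenDist_le (by linarith) fun m hm => ?_
    have h1 := (dist_le_bowenDist T M q q' hm).trans (h q hq q' hq' (hqi.trans hqi'.symm))
    have h2 := hy ⟨m, hm⟩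
    have h3 := hz ⟨m, hm⟩
    have h4 := dist_triangle4 (T^[m] y) (T^[m] q) (T^[m] q') (T^[m] z)
    rw [dist_comm (T^[m] q') (T^[m] z)] at h4
    simp only at h2 h3
    linarith

lemma logCoverNum_le_log {K : Set X} {ε : ℝ} {N : ℕ} (hN : 0 < N)
    (h : coverNum T M K ε ≤ (N : ℕ∞)) : logCoverNum T M K ε ≤ (Real.log N : ℝ) := by
  have h1 : (coverNum T M K ε : ENNReal) ≤ ENNReal.ofReal N := by
    rw [ENNReal.ofReal_natCast]
    exact_mod_cast ENat.toENNReal_le.2 h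
  rw [← ENNReal.log_ofReal_of_pos (Nat.cast_pos.2 hN)]
  exact ENNReal.log_le_log h1

/-- Pigeonhole: if a set of small Bowen diameter sees at most `L` values of `f`, then a cover needs
at least `(f '' Z).ncard / L` sets. The coding `f` lives on arrays, not on points, since expansions
need not be unique. -/
lemma le_logCoverNum {α β : Type*} [Finite β] {K : Set X} {ε : ℝ} (f : α → β) (g : α → X)
    (Z : Set α) (hZ : Z.Nonempty) (hK : ∀ z ∈ Z, g z ∈ K) {L : ℕ} (hL : 0 < L)
    (h : ∀ U : Set X, (∀ y ∈ U, ∀ z ∈ U, bowenDist T M y z ≤ ε) →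
      (f '' {z | z ∈ Z ∧ g z ∈ U}).ncard ≤ L) :
    ((Real.log (f '' Z).ncard - Real.log L : ℝ) : EReal) ≤ logCoverNum T M K ε := by
  have hpos : 0 < (f '' Z).ncard := (ncard_pos (toFinite _)).2 (hZ.image f)
  have h1 : ((⌈((f '' Z).ncard / L : ℝ)⌉₊ : ℕ) : ℕ∞) ≤ coverNum T M K ε := by
    refine le_iInf₂ fun n hn => ?_
    obtain ⟨-, U, -, hU, hd⟩ := hn
    rw [Nat.cast_le, Nat.ceil_le, div_le_iff₀ (Nat.cast_pos.2 hL)]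
    have hsub : f '' Z ⊆ ⋃ i ∈ (Finset.univ : Finset (Fin n)), f '' {z | z ∈ Z ∧ g z ∈ U i} := by
      rintro _ ⟨z, hz, rfl⟩
      obtain ⟨i, hi⟩ := mem_iUnion.1 (hU (hK z hz))
      simp only [mem_iUnion]
      exact ⟨i, Finset.mem_univ i, z, ⟨hz, hi⟩, rfl⟩
    have h2 : (f '' Z).ncard ≤ n * L := by
      refine (ncard_le_ncard hsub (toFinite _)).trans ?_
      refine (Finset.set_ncard_biUnion_le _ _).trans ?_
      refine (Finset.sum_le_card_nsmul _ _ L fun i _ => h _ (hd i)).trans ?_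
      simp
    exact_mod_cast h2
  have h3 : (0 : ℝ) < (f '' Z).ncard / L := by positivity
  rw [← Real.log_div (by positivity) (by positivity), ← ENNReal.log_ofReal_of_pos h3]
  refine ENNReal.log_le_log ?_
  refine (ENNReal.ofReal_le_ofReal (Nat.le_ceil _)).trans ?_
  rw [ENNReal.ofReal_natCast]
  exact_mod_cast ENat.toENNReal_le.2 h1

end Bowen

/-! ### Coding of carpets by digit arrays, and covering numbers of Bowen balls -/

namespace CarpetData

variable (D : CarpetData)

lemma one_lt_b : 1 < D.b := D.two_le_b

lemma one_lt_a : 1 < D.a := D.one_lt_b.trans D.b_lt_a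

lemma log_b_pos : 0 < Real.log D.b := Real.log_pos (Nat.one_lt_cast.2 D.one_lt_b)

lemma log_a_pos : 0 < Real.log D.a := Real.log_pos (Nat.one_lt_cast.2 D.one_lt_a)

lemma log_b_lt_log_a : Real.log D.b < Real.log D.a :=
  Real.log_lt_log (Nat.cast_pos.2 (zero_lt_one.trans D.one_lt_b)) (Nat.cast_lt.2 D.b_lt_a)

lemma ratio_pos : 0 < D.ratio := div_pos D.log_b_pos D.log_a_pos

lemma ratio_lt_one : D.ratio < 1 := (div_lt_one D.log_a_pos).2 D.log_b_lt_log_a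

/-- The letter of level `m` with the first entry kept for `m < k` and the second for `m < k'`. -/
def mask (k k' m : ℕ) (s : Fin D.a × Fin D.b) : Option (Fin D.a) × Option (Fin D.b) :=
  (if m < k then some s.1 else none, if m < k' then some s.2 else none)

/-- The point with the digits `ω`. -/
def toCube (ω : ℕ → ℕ → Fin D.a × Fin D.b) : CubePair where
  x n := ⟨Real.ofDigits fun m => (ω m n).1, Real.ofDigits_nonneg _, Real.ofDigits_le_one _⟩
  y n := ⟨Real.ofDigits fun m => (ω m n).2, Real.ofDigits_nonneg _, Real.ofDigits_le_one _⟩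

variable {D}

lemma toCube_mem {ω : ℕ → ℕ → Fin D.a × Fin D.b} (hω : ω ∈ arrays D.Ω) :
    D.toCube ω ∈ D.carpet :=
  ⟨ω, hω, fun _ => ⟨rfl, rfl⟩⟩

lemma exists_toCube_eq (p : D.carpet) : ∃ ω ∈ arrays D.Ω, D.toCube ω = p := by
  obtain ⟨p, ω, hω, hp⟩ := p
  refine ⟨ω, hω, ?_⟩
  ext n
  · exact (hp n).1.symm
  · exact (hp n).2.symm

variable (D) in
lemma arrays_nonempty : (arrays D.Ω).Nonempty :=
  D.nonempty.elim fun ω hω => ⟨fun _ => ω, fun _ => hω⟩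

instance : Nonempty D.carpet :=
  D.arrays_nonempty.elim fun _ hω => ⟨⟨_, toCube_mem hω⟩⟩

lemma coe_σ_iterate (m : ℕ) (p : D.carpet) :
    ((D.σ^[m] p : D.carpet) : CubePair) = CubePair.shift^[m] p := by
  induction m generalizing p with
  | zero => rfl
  | succ m ih =>
    rw [Function.iterate_succ_apply, ih, Function.iterate_succ_apply]
    rfl

lemma continuous_σ : Continuous D.σ := by
  refine LipschitzWith.continuous (K := 2) (LipschitzWith.of_dist_le_mul fun p q => ?_)
  exact CubePair.dist_shift_le p q

lemma bowenDist_le_add_pow {M : ℕ} (N : ℕ) {p q : D.carpet} {δ : ℝ} (hδ : 0 ≤ δ)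
    (h : ∀ n < M + N, |((p : CubePair).x n : ℝ) - (q : CubePair).x n| ≤ δ ∧
      |((p : CubePair).y n : ℝ) - (q : CubePair).y n| ≤ δ) :
    bowenDist D.σ M p q ≤ δ + (1 / 2) ^ N := by
  refine bowenDist_le (by positivity) fun m hm => ?_
  rw [Subtype.dist_eq, coe_σ_iterate, coe_σ_iterate]
  refine CubePair.dist_le_add_pow N _ _ (fun n hn => ?_) hδ
  simp only [CubePair.shift_iterate_x, CubePair.shift_iterate_y]
  exact h _ (by omega)

lemma max_le_two_mul_bowenDist {M n : ℕ} (hn : n < M) (p q : D.carpet) :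
    max |((p : CubePair).x n : ℝ) - (q : CubePair).x n|
      |((p : CubePair).y n : ℝ) - (q : CubePair).y n| ≤ 2 * bowenDist D.σ M p q := by
  have h1 := dist_le_bowenDist D.σ M p q hn
  rw [Subtype.dist_eq, coe_σ_iterate, coe_σ_iterate] at h1
  have h2 := CubePair.max_le_two_mul_dist (CubePair.shift^[n] p) (CubePair.shift^[n] q)
  simp only [CubePair.shift_iterate_x, CubePair.shift_iterate_y, add_zero] at h2
  linarith

lemma pattern_mask_eq_iff {k k' J W : ℕ} {ω ω' : ℕ → ℕ → Fin D.a × Fin D.b} :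
    pattern (D.mask k k') J W ω = pattern (D.mask k k') J W ω' ↔
      ∀ m < J, ∀ n < W, (m < k → (ω m n).1 = (ω' m n).1) ∧ (m < k' → (ω m n).2 = (ω' m n).2) := by
  constructor
  · intro h m hm n hn
    have h1 := congrFun (congrFun h ⟨m, hm⟩) ⟨n, hn⟩
    simp only [pattern, mask, Prod.mk.injEq] at h1
    refine ⟨fun hk => ?_, fun hk => ?_⟩
    · simpa [hk] using h1.1
    · simpa [hk] using h1.2
  · intro h
    funext m n
    have h1 := h m m.2 n n.2
    simp only [pattern, mask, Prod.mk.injEq]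
    constructor
    · split_ifs with hk
      · rw [h1.1 hk]
      · rfl
    · split_ifs with hk
      · rw [h1.2 hk]
      · rfl

lemma abs_sub_le_of_pattern_eq {k k' J W : ℕ} {ω ω' : ℕ → ℕ → Fin D.a × Fin D.b}
    (h : pattern (D.mask k k') J W ω = pattern (D.mask k k') J W ω') (hk : k ≤ J) (hk' : k' ≤ J)
    {n : ℕ} (hn : n < W) :
    |((D.toCube ω).x n : ℝ) - (D.toCube ω').x n| ≤ ((D.a : ℝ) ^ k)⁻¹ ∧
      |((D.toCube ω).y n : ℝ) - (D.toCube ω').y n| ≤ ((D.b : ℝ) ^ k')⁻¹ := by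
  rw [pattern_mask_eq_iff] at h
  exact ⟨Real.abs_ofDigits_sub_ofDigits_le fun i hi => (h i (by omega) n hn).1 hi,
    Real.abs_ofDigits_sub_ofDigits_le fun i hi => (h i (by omega) n hn).2 hi⟩

lemma ncard_pattern_mask_le_of_close {k k' : ℕ} (J : ℕ) {M : ℕ} {Z : Set (ℕ → ℕ → Fin D.a × Fin D.b)}
    (ω₀ : ℕ → ℕ → Fin D.a × Fin D.b)
    (h : ∀ ω ∈ Z, ∀ n < M,
      |((D.toCube ω).x n : ℝ) - (D.toCube ω₀).x n| ≤ 2 * ((D.a : ℝ) ^ k)⁻¹ ∧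
      |((D.toCube ω).y n : ℝ) - (D.toCube ω₀).y n| ≤ 2 * ((D.b : ℝ) ^ k')⁻¹) :
    (pattern (D.mask k k') J M '' Z).ncard ≤ 49 ^ M := by
  -- Both digit integers lie within 3 of those of `ω₀`, so two candidates differ by at most 6 and
  -- residues mod 7 separate them; two coordinates give `49 = 7 ^ 2` per time.
  let g : (ℕ → ℕ → Fin D.a × Fin D.b) → Fin M → ZMod 7 × ZMod 7 := fun ω n =>
    ((digitNat (fun m => (ω m n).1) k : ℕ), (digitNat (fun m => (ω m n).2) k' : ℕ))
  refine (ncard_image_le_of_factor _ g Z fun ω hω ω' hω' hg => ?_).trans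
    ((ncard_le_card _).trans_eq ?_)
  · rw [pattern_mask_eq_iff]
    intro m _ n hn
    have h1 := congrFun hg ⟨n, hn⟩
    simp only [g, Prod.mk.injEq, ZMod.natCast_eq_natCast_iff'] at h1
    have hx := digitNat_close (h ω hω n hn).1
    have hx' := digitNat_close (h ω' hω' n hn).1
    have hy := digitNat_close (h ω hω n hn).2
    have hy' := digitNat_close (h ω' hω' n hn).2
    exact ⟨eq_of_digitNat_eq (s := fun m => (ω m n).1) (s' := fun m => (ω' m n).1) (by omega) m,
      eq_of_digitNat_eq (s := fun m => (ω m n).2) (s' := fun m => (ω' m n).2) (by omega) m⟩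
  · simp [Nat.card_eq_fintype_card, ZMod.card]

lemma logCoverNum_bowenBall_le {k k' l l' J N : ℕ} (hl : l ≤ J) (hl' : l' ≤ J)
    {r ρ : ℝ} (hρ : 0 < ρ)
    (hr : r ≤ ((D.a : ℝ) ^ k)⁻¹) (hr' : r ≤ ((D.b : ℝ) ^ k')⁻¹)
    (hal : ((D.a : ℝ) ^ l)⁻¹ ≤ ρ / 6) (hbl : ((D.b : ℝ) ^ l')⁻¹ ≤ ρ / 6)
    (hN : (1 / 2 : ℝ) ^ N ≤ ρ / 6) (hr0 : 0 ≤ r) (M : ℕ) (p : D.carpet) :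
    logCoverNum D.σ M (bowenBall D.σ M p r) ρ ≤
      ((∑ m : Fin J, Real.log (fiberCount D.Ω (D.mask k k' m) (D.mask l l' m) M) +
        M * Real.log 49 +
        Real.log ((Fintype.card (Option (Fin D.a) × Option (Fin D.b)) ^ (J * N) : ℕ)) : ℝ) :
        EReal) := by
  classical
  -- Expansions need not be unique, so one array is fixed for each point.
  choose c hc hcp using fun p : D.carpet => exists_toCube_eq p
  set K := bowenBall D.σ M p r
  have hK : K.Nonempty := ⟨p, bowenDist_le hr0 fun m _ => by simpa using hr0⟩
  have h1 : coverNum D.σ M K ρ ≤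
      (((fun p => pattern (D.mask l l') J (M + N) (c p)) '' K).ncard : ℕ∞) := by
    -- Half of `ρ / 3` pays for the unseen digits and half for coordinates beyond `M + N`; the
    -- threefold loss of the open cover then gives `ρ`.
    refine coverNum_le_of_factor continuous_σ hK _ (δ := ρ / 3) (by positivity) (by linarith)
      fun q _ q' _ h => ?_
    refine (bowenDist_le_add_pow N (δ := ρ / 6) (by positivity) fun n hn => ?_).trans
      (by linarith : ρ / 6 + (1 / 2) ^ N ≤ ρ / 3)
    have := abs_sub_le_of_pattern_eq h hl hl' hn
    rw [hcp, hcp] at this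
    exact ⟨this.1.trans hal, this.2.trans hbl⟩
  have himg : ((fun p => pattern (D.mask l l') J (M + N) (c p)) '' K) =
      pattern (D.mask l l') J (M + N) '' (c '' K) := (image_image _ _ _).symm
  have h2 : (pattern (D.mask k k') J M '' (c '' K)).ncard ≤ 49 ^ M := by
    refine ncard_pattern_mask_le_of_close J (c p) ?_
    rintro _ ⟨q, hq, rfl⟩ n hn
    rw [hcp, hcp]
    have h3 := max_le_two_mul_bowenDist hn p q
    have h4 : bowenDist D.σ M p q ≤ r := hq
    rw [abs_sub_comm ((q : CubePair).x n : ℝ), abs_sub_comm ((q : CubePair).y n : ℝ)]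
    have h5 := le_max_left |((p : CubePair).x n : ℝ) - (q : CubePair).x n|
      |((p : CubePair).y n : ℝ) - (q : CubePair).y n|
    have h6 := le_max_right |((p : CubePair).x n : ℝ) - (q : CubePair).x n|
      |((p : CubePair).y n : ℝ) - (q : CubePair).y n|
    constructor <;> linarith
  have h3 : (pattern (D.mask l l') J M '' (c '' K)).ncard ≤
      49 ^ M * ∏ m : Fin J, fiberCount D.Ω (D.mask k k' m) (D.mask l l' m) M := by
    refine (ncard_image_le_mul _ (pattern (D.mask k k') J M) _ _ fun κ => ?_).trans
      (Nat.mul_le_mul_right _ h2)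
    refine (ncard_le_ncard (image_mono ?_) (toFinite _)).trans
      (ncard_pattern_fiber_le D.Ω (D.mask k k') (D.mask l l') J M κ)
    rintro _ ⟨⟨q, -, rfl⟩, hq⟩
    exact ⟨hc q, hq⟩
  have h4 := (ncard_pattern_add_le (D.mask l l') J M N (c '' K)).trans
    (Nat.mul_le_mul_right _ h3)
  rw [← himg] at h4
  have hpos : ∀ m : Fin J, fiberCount D.Ω (D.mask k k' m) (D.mask l l' m) M ≠ 0 := fun m =>
    (fiberCount_pos D.nonempty _ _ _).ne'
  have hcard : Fintype.card (Option (Fin D.a) × Option (Fin D.b)) ≠ 0 := Fintype.card_ne_zero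
  have hne : (49 ^ M * ∏ m : Fin J, fiberCount D.Ω (D.mask k k' m) (D.mask l l' m) M) *
      Fintype.card (Option (Fin D.a) × Option (Fin D.b)) ^ (J * N) ≠ 0 :=
    mul_ne_zero (mul_ne_zero (by positivity) (Finset.prod_ne_zero_iff.2 fun m _ => hpos m))
      (pow_ne_zero _ hcard)
  refine (logCoverNum_le_log (Nat.pos_of_ne_zero hne)
    (h1.trans (Nat.cast_le.2 h4))).trans_eq ?_
  rw [Nat.cast_mul, Real.log_mul, Nat.cast_mul, Real.log_mul, Nat.cast_prod, Real.log_prod]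
  · congr 2
    rw [add_comm]
    simp
  · exact fun m _ => Nat.cast_ne_zero.2 (hpos m)
  · positivity
  · exact Nat.cast_ne_zero.2 (Finset.prod_ne_zero_iff.2 fun m _ => hpos m)
  · exact Nat.cast_ne_zero.2 (left_ne_zero_of_mul hne)
  · exact Nat.cast_ne_zero.2 (right_ne_zero_of_mul hne)

lemma exists_le_logCoverNum_bowenBall {k k' l l' J N : ℕ} (hk : k ≤ J) (hk' : k' ≤ J)
    {r ρ : ℝ} (hr : 0 < r)
    (hak : ((D.a : ℝ) ^ k)⁻¹ ≤ r / 2) (hbk : ((D.b : ℝ) ^ k')⁻¹ ≤ r / 2)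
    (hN : (1 / 2 : ℝ) ^ N ≤ r / 2)
    (hal : ρ ≤ ((D.a : ℝ) ^ l)⁻¹) (hbl : ρ ≤ ((D.b : ℝ) ^ l')⁻¹) (M : ℕ) :
    ∃ p : D.carpet,
      ((∑ m : Fin J, Real.log (fiberCount D.Ω (D.mask k k' m) (D.mask l l' m) (M + N)) -
        M * Real.log 49 -
        Real.log ((Fintype.card (Option (Fin D.a) × Option (Fin D.b)) ^ (J * N) : ℕ)) : ℝ) :
        EReal) ≤ logCoverNum D.σ M (bowenBall D.σ M p r) ρ := by
  classical
  obtain ⟨κ, hκ⟩ := exists_le_ncard_pattern_fiber D.nonempty (D.mask k k') (D.mask l l') J (M + N)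
  -- The known digits are prescribed up to time `M + N`, so that all of `Z` maps into one Bowen ball
  -- of radius `r`.
  set Z := {ω | ω ∈ arrays D.Ω ∧ pattern (D.mask k k') J (M + N) ω = κ}
  have hpos : ∀ m : Fin J, 0 < fiberCount D.Ω (D.mask k k' m) (D.mask l l' m) (M + N) := fun m =>
    fiberCount_pos D.nonempty _ _ _
  have hprod := Finset.prod_pos fun m (_ : m ∈ Finset.univ) => hpos m
  have hZ : Z.Nonempty := by
    by_contra h
    rw [not_nonempty_iff_eq_empty] at h
    rw [h, image_empty, ncard_empty] at hκ
    omega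
  obtain ⟨ω₀, hω₀⟩ := hZ
  let p₀ : D.carpet := ⟨D.toCube ω₀, toCube_mem hω₀.1⟩
  let g : (ℕ → ℕ → Fin D.a × Fin D.b) → D.carpet := fun ω =>
    -- The value `p₀` off the arrays is a dummy: `g` is used only on `Z`.
    if h : ω ∈ arrays D.Ω then ⟨D.toCube ω, toCube_mem h⟩ else p₀
  have hg : ∀ ω ∈ Z, (g ω : CubePair) = D.toCube ω := fun ω hω => by simp [g, hω.1]
  refine ⟨p₀, ?_⟩
  have h1 := le_logCoverNum (T := D.σ) (M := M) (K := bowenBall D.σ M p₀ r) (ε := ρ)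
    (pattern (D.mask l l') J M) g Z ⟨ω₀, hω₀⟩ (fun ω hω => ?_) (L := 49 ^ M) (by positivity)
    fun U hU => ?_
  · refine le_trans (EReal.coe_le_coe_iff.2 ?_) h1
    have h2 := hκ.trans (ncard_pattern_add_le (D.mask l l') J M N Z)
    have h3 : 0 < (pattern (D.mask l l') J M '' Z).ncard :=
      (ncard_pos (toFinite _)).2 (image_nonempty.2 ⟨ω₀, hω₀⟩)
    have hcard : 0 < Fintype.card (Option (Fin D.a) × Option (Fin D.b)) ^ (J * N) :=
      pow_pos Fintype.card_pos _
    have h4 : Real.log ((∏ m : Fin J,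
        fiberCount D.Ω (D.mask k k' m) (D.mask l l' m) (M + N) : ℕ) : ℝ) ≤
        Real.log (pattern (D.mask l l') J M '' Z).ncard + Real.log
          ((Fintype.card (Option (Fin D.a) × Option (Fin D.b)) ^ (J * N) : ℕ)) := by
      rw [← Real.log_mul (Nat.cast_pos.2 h3).ne' (Nat.cast_pos.2 hcard).ne']
      refine Real.log_le_log (Nat.cast_pos.2 hprod) ?_
      exact_mod_cast h2
    rw [Nat.cast_prod, Real.log_prod fun m _ => (Nat.cast_pos.2 (hpos m)).ne'] at h4
    have h5 : Real.log ((49 ^ M : ℕ) : ℝ) = M * Real.log 49 := by simp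
    rw [h5]
    linarith
  · have h2 := bowenDist_le_add_pow (M := M) N (p := p₀) (q := g ω) (δ := r / 2) (by positivity)
      fun n hn => ?_
    · exact h2.trans (by linarith)
    · rw [hg ω hω]
      have := abs_sub_le_of_pattern_eq (hω₀.2.trans hω.2.symm) hk hk' hn
      exact ⟨this.1.trans hak, this.2.trans hbk⟩
  · rcases {z | z ∈ Z ∧ g z ∈ U}.eq_empty_or_nonempty with he | ⟨ω₁, hω₁, hU₁⟩
    · simp [he]
    · refine ncard_pattern_mask_le_of_close J ω₁ ?_
      rintro ω ⟨hω, hωU⟩ n hn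
      have h3 := max_le_two_mul_bowenDist hn (g ω) (g ω₁)
      have h4 := hU _ hωU _ hU₁
      rw [hg ω hω, hg ω₁ hω₁] at h3
      have h5 := (le_max_left _ _).trans h3
      have h6 := (le_max_right _ _).trans h3
      constructor <;> linarith

lemma localGrowth_le_sum {k k' l l' J : ℕ} (hl : l ≤ J) (hl' : l' ≤ J)
    {r ρ : ℝ} (hρ : 0 < ρ) (hr0 : 0 ≤ r)
    (hr : r ≤ ((D.a : ℝ) ^ k)⁻¹) (hr' : r ≤ ((D.b : ℝ) ^ k')⁻¹)
    (hal : ((D.a : ℝ) ^ l)⁻¹ ≤ ρ / 6) (hbl : ((D.b : ℝ) ^ l')⁻¹ ≤ ρ / 6) :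
    localGrowth D.σ r ρ ≤
      ((∑ m : Fin J, fiberEntropy D.Ω (D.mask k k' m) (D.mask l l' m) + Real.log 49 : ℝ) :
        EReal) := by
  obtain ⟨N, hN⟩ := exists_pow_lt_of_lt_one (show 0 < ρ / 6 by positivity)
    (show (1 / 2 : ℝ) < 1 by norm_num)
  set B := Real.log ((Fintype.card (Option (Fin D.a) × Option (Fin D.b)) ^ (J * N) : ℕ))
  -- `N` and `B` depend on the scales but not on `M`, so only `log 49` survives as error.
  have hlim : Tendsto (fun M : ℕ =>
      ∑ m : Fin J, Real.log (fiberCount D.Ω (D.mask k k' m) (D.mask l l' m) M) / M +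
        Real.log 49 + B / M) atTop
      (𝓝 (∑ m : Fin J, fiberEntropy D.Ω (D.mask k k' m) (D.mask l l' m) + Real.log 49 + 0)) :=
    ((tendsto_finsetSum _ fun m _ => tendsto_fiberEntropy D.nonempty D.shift_mem _ _).add
      tendsto_const_nhds).add (tendsto_const_div_atTop_nhds_zero_nat B)
  rw [add_zero] at hlim
  rw [← ((continuous_coe_real_ereal.tendsto _).comp hlim).limsup_eq]
  refine limsup_le_limsup ?_
  filter_upwards [eventually_gt_atTop 0] with M hM
  have hM' : (0 : ℝ) < M := Nat.cast_pos.2 hM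
  refine (EReal.div_le_div_right_of_nonneg (EReal.coe_nonneg.2 hM'.le) (iSup_le fun p =>
    logCoverNum_bowenBall_le hl hl' hρ hr hr' hal hbl hN.le hr0 M p)).trans_eq ?_
  rw [← EReal.coe_div, Function.comp_apply, EReal.coe_eq_coe_iff, add_div, add_div,
    Finset.sum_div, mul_div_cancel_left₀ _ hM'.ne']

lemma sum_le_localGrowth {k k' l l' J : ℕ} (hk : k ≤ J) (hk' : k' ≤ J)
    {r ρ : ℝ} (hr : 0 < r)
    (hak : ((D.a : ℝ) ^ k)⁻¹ ≤ r / 2) (hbk : ((D.b : ℝ) ^ k')⁻¹ ≤ r / 2)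
    (hal : ρ ≤ ((D.a : ℝ) ^ l)⁻¹) (hbl : ρ ≤ ((D.b : ℝ) ^ l')⁻¹) :
    ((∑ m : Fin J, fiberEntropy D.Ω (D.mask k k' m) (D.mask l l' m) - Real.log 49 : ℝ) :
        EReal) ≤ localGrowth D.σ r ρ := by
  obtain ⟨N, hN⟩ := exists_pow_lt_of_lt_one (show 0 < r / 2 by positivity)
    (show (1 / 2 : ℝ) < 1 by norm_num)
  set B := Real.log ((Fintype.card (Option (Fin D.a) × Option (Fin D.b)) ^ (J * N) : ℕ))
  have hlim : Tendsto (fun M : ℕ =>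
      ∑ m : Fin J, fiberEntropy D.Ω (D.mask k k' m) (D.mask l l' m) - Real.log 49 - B / M) atTop
      (𝓝 (∑ m : Fin J, fiberEntropy D.Ω (D.mask k k' m) (D.mask l l' m) - Real.log 49 - 0)) :=
    tendsto_const_nhds.sub (tendsto_const_div_atTop_nhds_zero_nat B)
  rw [sub_zero] at hlim
  rw [← ((continuous_coe_real_ereal.tendsto _).comp hlim).limsup_eq]
  refine limsup_le_limsup ?_
  filter_upwards [eventually_gt_atTop 0] with M hM
  have hM' : (0 : ℝ) < M := Nat.cast_pos.2 hM
  obtain ⟨p, hp⟩ := exists_le_logCoverNum_bowenBall hk hk' hr hak hbk hN.le hal hbl M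
  refine le_trans ?_ (EReal.div_le_div_right_of_nonneg (EReal.coe_nonneg.2 hM'.le)
    (hp.trans (le_iSup (fun p => logCoverNum D.σ M (bowenBall D.σ M p r) ρ) p)))
  rw [← EReal.coe_div, Function.comp_apply, EReal.coe_le_coe_iff, le_div_iff₀ hM', sub_mul,
    sub_mul, div_mul_cancel₀ _ hM'.ne', Finset.sum_mul, mul_comm (Real.log 49)]
  refine sub_le_sub_right (sub_le_sub_right (Finset.sum_le_sum fun m _ => ?_) _) _
  -- By subadditivity the rate bounds the count from below at every length, so no limit is needed on
  -- this side.
  refine le_trans ?_ (mul_fiberEntropy_le D.nonempty D.shift_mem _ _ _)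
  rw [mul_comm]
  refine mul_le_mul_of_nonneg_right ?_ (fiberEntropy_nonneg D.nonempty D.shift_mem _ _)
  exact_mod_cast Nat.le_add_right M N

end CarpetData

/-- The growth of a carpet system with dimensions `A`, `M` and ratio `κ` between the scales
`exp (-v) ≤ exp (-u)`, up to a bounded error. -/
def profile (κ A M u v : ℝ) : ℝ :=
  A * (min v (u / κ) - u) + M * (v - min v (u / κ))

/-! ### Entropies of the levels, and the growth rate up to a bounded error -/

namespace CarpetData

variable (D : CarpetData)

/-- The entropy of `Ω`. -/
def entropy : ℝ := fiberEntropy D.Ω (D.mask 0 0 0) (D.mask 1 1 0)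

/-- The entropy of the projection of `Ω` to `B^ℕ`. -/
def entropyY : ℝ := fiberEntropy D.Ω (D.mask 0 0 0) (D.mask 0 1 0)

/-- The largest exponential growth rate of `Ω` over a word of its projection to `B^ℕ`. -/
def entropyX : ℝ := fiberEntropy D.Ω (D.mask 0 1 0) (D.mask 1 1 0)

lemma entropy_nonneg : 0 ≤ D.entropy := fiberEntropy_nonneg D.nonempty D.shift_mem _ _

lemma entropyY_nonneg : 0 ≤ D.entropyY := fiberEntropy_nonneg D.nonempty D.shift_mem _ _

lemma entropyX_nonneg : 0 ≤ D.entropyX := fiberEntropy_nonneg D.nonempty D.shift_mem _ _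

lemma entropy_le : D.entropy ≤ D.entropyY + D.entropyX :=
  fiberEntropy_le_add D.nonempty D.shift_mem _ _ _

/-- Only which digits are known and which are wanted at level `m` matters. The order of the
thresholds rules out keeping x without y, so three nonzero cases remain. -/
lemma fiberEntropy_mask {k k' l l' : ℕ} (hk : k ≤ k') (hl : l ≤ l') (m : ℕ) :
    fiberEntropy D.Ω (D.mask k k' m) (D.mask l l' m) =
      (if k ≤ m ∧ m < min k' l then D.entropyX else 0) + (if k' ≤ m ∧ m < l then D.entropy else 0) +
        (if max l k' ≤ m ∧ m < l' then D.entropyY else 0) := by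
  have h11 : ∀ {k k' : ℕ}, m < k → m < k' → D.mask k k' m = D.mask 1 1 0 := fun h h' => by
    funext s; simp [mask, h, h']
  have h01 : ∀ {k k' : ℕ}, ¬ m < k → m < k' → D.mask k k' m = D.mask 0 1 0 := fun h h' => by
    funext s; simp [mask, h, h']
  have h00 : ∀ {k k' : ℕ}, ¬ m < k → ¬ m < k' → D.mask k k' m = D.mask 0 0 0 := fun h h' => by
    funext s; simp [mask, h, h']
  have e1 : ∀ T, fiberEntropy D.Ω (D.mask 1 1 0) (D.mask T 1 0) = 0 ∧
      fiberEntropy D.Ω (D.mask 1 1 0) (D.mask T 0 0) = 0 := fun T =>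
    ⟨fiberEntropy_eq_zero D.nonempty D.shift_mem fun s s' h => by
        simp only [mask] at h ⊢; simp at h; rw [h.1, h.2],
      fiberEntropy_eq_zero D.nonempty D.shift_mem fun s s' h => by
        simp only [mask] at h ⊢; simp at h; rw [h.1, h.2]⟩
  have e2 : ∀ k', fiberEntropy D.Ω (D.mask 0 1 0) (D.mask 0 k' 0) = 0 := fun k' =>
    fiberEntropy_eq_zero D.nonempty D.shift_mem fun s s' h => by
        simp [mask] at h ⊢; rw [h]
  have e3 : ∀ K, fiberEntropy D.Ω K (D.mask 0 0 0) = 0 := fun K =>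
    fiberEntropy_eq_zero D.nonempty D.shift_mem fun s s' h => by
        simp [mask]
  rcases lt_or_ge m k with c1 | c1
  · rw [if_neg (by omega), if_neg (by omega), if_neg (by omega), h11 c1 (by omega)]
    rcases lt_or_ge m l with c3 | c3
    · rw [h11 c3 (by omega), (e1 1).1]; simp
    · rcases lt_or_ge m l' with c4 | c4
      · rw [h01 c3.not_gt c4, (e1 0).1]; simp
      · rw [h00 c3.not_gt c4.not_gt, e3]; simp
  · rcases lt_or_ge m k' with c2 | c2
    · rw [h01 c1.not_gt c2, if_neg (by omega : ¬ (k' ≤ m ∧ m < l)),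
        if_neg (by omega : ¬ (max l k' ≤ m ∧ m < l'))]
      rcases lt_or_ge m l with c3 | c3
      · rw [h11 c3 (by omega), if_pos (by omega)]; simp [entropyX]
      · rw [if_neg (by omega)]
        rcases lt_or_ge m l' with c4 | c4
        · rw [h01 c3.not_gt c4, e2]; simp
        · rw [h00 c3.not_gt c4.not_gt, e3]; simp
    · rw [h00 c1.not_gt c2.not_gt, if_neg (by omega : ¬ (k ≤ m ∧ m < min k' l))]
      rcases lt_or_ge m l with c3 | c3
      · rw [h11 c3 (by omega), if_pos (by omega), if_neg (by omega)]; simp [entropy]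
      · rw [if_neg (by omega)]
        rcases lt_or_ge m l' with c4 | c4
        · rw [h01 c3.not_gt c4, if_pos (by omega)]; simp [entropyY]
        · rw [h00 c3.not_gt c4.not_gt, e3, if_neg (by omega)]; simp

lemma sum_ite_Ico {p q J : ℕ} (hq : q ≤ J) (c : ℝ) :
    ∑ m ∈ Finset.range J, (if p ≤ m ∧ m < q then c else 0) = c * ((q - p : ℕ) : ℝ) := by
  have h : (Finset.range J).filter (fun m => p ≤ m ∧ m < q) = Finset.Ico p q := by
    ext m
    simp only [Finset.mem_filter, Finset.mem_range, Finset.mem_Ico]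
    omega
  rw [← Finset.sum_filter, h, Finset.sum_const, Nat.card_Ico, nsmul_eq_mul, mul_comm]

lemma sum_fiberEntropy_mask {k k' l l' J : ℕ} (hk : k ≤ k') (hl : l ≤ l') (hJ : l' ≤ J) :
    ∑ m : Fin J, fiberEntropy D.Ω (D.mask k k' m) (D.mask l l' m) =
      D.entropyX * ((min k' l - k : ℕ) : ℝ) + D.entropy * ((l - k' : ℕ) : ℝ) +
        D.entropyY * ((l' - max l k' : ℕ) : ℝ) := by
  simp_rw [D.fiberEntropy_mask hk hl]
  rw [Fin.sum_univ_eq_sum_range fun m =>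
      (if k ≤ m ∧ m < min k' l then D.entropyX else 0) + (if k' ≤ m ∧ m < l then D.entropy else 0) +
        (if max l k' ≤ m ∧ m < l' then D.entropyY else 0), Finset.sum_add_distrib,
    Finset.sum_add_distrib, sum_ite_Ico (by omega), sum_ite_Ico (by omega), sum_ite_Ico hJ]

/-- The mean Assouad dimension of the system. -/
def dimA : ℝ := D.entropyX / Real.log D.a + D.entropyY / Real.log D.b

/-- The metric mean dimension of the system. -/
def dimM : ℝ :=
  D.entropy / Real.log D.a + (1 / Real.log D.b - 1 / Real.log D.a) * D.entropyY

lemma dimM_nonneg : 0 ≤ D.dimM := by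
  have h1 := D.log_a_pos
  have h2 := D.log_b_pos
  have h3 := one_div_le_one_div_of_le h2 D.log_b_lt_log_a.le
  exact add_nonneg (div_nonneg D.entropy_nonneg h1.le)
    (mul_nonneg (sub_nonneg.2 h3) D.entropyY_nonneg)

lemma dimM_le_dimA : D.dimM ≤ D.dimA := by
  have h : D.dimA - D.dimM = (D.entropyY + D.entropyX - D.entropy) / Real.log D.a := by
    unfold dimA dimM
    ring
  have := div_nonneg (sub_nonneg.2 D.entropy_le) D.log_a_pos.le
  linarith

lemma profile_eq (u v : ℝ) : profile D.ratio D.dimA D.dimM u v =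
    D.entropyX * (min (u / Real.log D.b) (v / Real.log D.a) - u / Real.log D.a) +
      D.entropy * (v / Real.log D.a - min (u / Real.log D.b) (v / Real.log D.a)) +
      D.entropyY * (v / Real.log D.b - max (v / Real.log D.a) (u / Real.log D.b)) := by
  have h1 := D.log_a_pos
  have h2 := D.log_b_pos
  have h3 : u / D.ratio = u / Real.log D.b * Real.log D.a := by
    unfold ratio
    field_simp
  unfold profile dimA dimM
  rw [h3]
  rcases le_total (v / Real.log D.a) (u / Real.log D.b) with h | h
  · have h4 := h
    rw [div_le_iff₀ h1] at h4
    rw [min_eq_left h4, min_eq_right h, max_eq_right h]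
    field_simp
    ring
  · have h4 := h
    rw [le_div_iff₀ h1] at h4
    rw [min_eq_right h4, min_eq_left h, max_eq_left h]
    field_simp
    ring

lemma inv_pow_le {n k : ℕ} (hn : 0 < n) {t c : ℝ} (ht : 0 < t)
    (h : -Real.log t + Real.log c ≤ k * Real.log n) (hc : 0 < c) : ((n : ℝ) ^ k)⁻¹ ≤ t / c := by
  have hn' : (0 : ℝ) < (n : ℝ) := Nat.cast_pos.2 hn
  rw [← Real.log_le_log_iff (by positivity) (by positivity), Real.log_inv, Real.log_pow,
    Real.log_div ht.ne' hc.ne']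
  linarith

lemma le_inv_pow {n k : ℕ} (hn : 0 < n) {t : ℝ} (ht : 0 < t)
    (h : k * Real.log n ≤ -Real.log t) : t ≤ ((n : ℝ) ^ k)⁻¹ := by
  have hn' : (0 : ℝ) < (n : ℝ) := Nat.cast_pos.2 hn
  rw [← Real.log_le_log_iff ht (by positivity), Real.log_inv, Real.log_pow]
  linarith

lemma log_two_le {n : ℕ} (hn : 2 ≤ n) : Real.log 2 ≤ Real.log n :=
  Real.log_le_log (by norm_num) (by exact_mod_cast hn)

lemma log_six_le {n : ℕ} (hn : 2 ≤ n) : Real.log 6 ≤ 3 * Real.log n := by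
  have h1 : Real.log 6 ≤ Real.log ((2 : ℝ) ^ 3) := Real.log_le_log (by norm_num) (by norm_num)
  rw [Real.log_pow] at h1
  have := log_two_le hn
  push_cast at h1
  linarith

lemma le_inv_pow_floor {n : ℕ} (hn : 2 ≤ n) {t : ℝ} (ht : 0 < t) (h : t ≤ 1) :
    t ≤ ((n : ℝ) ^ ⌊-Real.log t / Real.log n⌋₊)⁻¹ := by
  have hlog : 0 < Real.log n := Real.log_pos (by exact_mod_cast hn)
  refine le_inv_pow (by omega) ht ?_
  rw [← le_div_iff₀ hlog]
  exact Nat.floor_le (div_nonneg (neg_nonneg.2 (Real.log_nonpos ht.le h)) hlog.le)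

lemma inv_pow_floor_add_le {n : ℕ} (hn : 2 ≤ n) {t c : ℝ} (ht : 0 < t) (hc : 0 < c) {j : ℕ}
    (hj : Real.log c ≤ j * Real.log n) :
    ((n : ℝ) ^ (⌊-Real.log t / Real.log n⌋₊ + (j + 1)))⁻¹ ≤ t / c := by
  have hlog : 0 < Real.log n := Real.log_pos (by exact_mod_cast hn)
  refine inv_pow_le (by omega) ht ?_ hc
  have h1 := (Nat.lt_floor_add_one (-Real.log t / Real.log n)).le
  rw [div_le_iff₀ hlog] at h1
  push_cast
  linarith

lemma floor_bounds {x : ℝ} (hx : 0 ≤ x) : (⌊x⌋₊ : ℝ) ≤ x ∧ x - 1 ≤ ⌊x⌋₊ :=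
  ⟨Nat.floor_le hx, by linarith [Nat.lt_floor_add_one x]⟩

lemma localGrowth_le_profile {r ρ : ℝ} (hρ : 0 < ρ) (hρr : ρ ≤ r) (hr : r ≤ 1) :
    localGrowth D.σ r ρ ≤ ((profile D.ratio D.dimA D.dimM (-Real.log r) (-Real.log ρ) +
      (5 * (D.entropyX + D.entropy + D.entropyY) + Real.log 49) : ℝ) : EReal) := by
  have hr0 := hρ.trans_le hρr
  have hla := D.log_a_pos
  have hlb := D.log_b_pos
  have hab := D.log_b_lt_log_a
  have hu : 0 ≤ -Real.log r := neg_nonneg.2 (Real.log_nonpos hr0.le hr)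
  have huv : -Real.log r ≤ -Real.log ρ := neg_le_neg (Real.log_le_log hρ hρr)
  have hv := hu.trans huv
  have ha2 : 2 ≤ D.a := D.one_lt_a
  have hk := le_inv_pow_floor ha2 hr0 hr
  have hk' := le_inv_pow_floor D.two_le_b hr0 hr
  -- Precision `ρ / 6` needs three digits more than `ρ`, as `6 ≤ 2 ^ 3`, and one more makes up for
  -- the floor.
  have hl := inv_pow_floor_add_le ha2 hρ (by norm_num : (0 : ℝ) < 6) (j := 3)
    (by exact_mod_cast log_six_le ha2)
  have hl' := inv_pow_floor_add_le D.two_le_b hρ (by norm_num : (0 : ℝ) < 6) (j := 3)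
    (by exact_mod_cast log_six_le D.two_le_b)
  have hkk : ⌊-Real.log r / Real.log D.a⌋₊ ≤ ⌊-Real.log r / Real.log D.b⌋₊ :=
    Nat.floor_mono (div_le_div_of_nonneg_left hu hlb hab.le)
  have hll : ⌊-Real.log ρ / Real.log D.a⌋₊ ≤ ⌊-Real.log ρ / Real.log D.b⌋₊ :=
    Nat.floor_mono (div_le_div_of_nonneg_left hv hlb hab.le)
  have hkl : ⌊-Real.log r / Real.log D.a⌋₊ ≤ ⌊-Real.log ρ / Real.log D.a⌋₊ :=
    Nat.floor_mono (div_le_div_of_nonneg_right huv hla.le)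
  have hkl' : ⌊-Real.log r / Real.log D.b⌋₊ ≤ ⌊-Real.log ρ / Real.log D.b⌋₊ :=
    Nat.floor_mono (div_le_div_of_nonneg_right huv hlb.le)
  refine (localGrowth_le_sum (J := ⌊-Real.log ρ / Real.log D.b⌋₊ + (3 + 1)) (by omega) le_rfl hρ
    hr0.le hk hk' hl hl').trans (EReal.coe_le_coe_iff.2 ?_)
  rw [D.sum_fiberEntropy_mask hkk (by omega) le_rfl, profile_eq]
  obtain ⟨b1, b1'⟩ := floor_bounds (div_nonneg hu hla.le)
  obtain ⟨b2, b2'⟩ := floor_bounds (div_nonneg hu hlb.le)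
  obtain ⟨b3, b3'⟩ := floor_bounds (div_nonneg hv hla.le)
  obtain ⟨b4, b4'⟩ := floor_bounds (div_nonneg hv hlb.le)
  set k := ⌊-Real.log r / Real.log D.a⌋₊
  set k' := ⌊-Real.log r / Real.log D.b⌋₊
  set l := ⌊-Real.log ρ / Real.log D.a⌋₊
  set l' := ⌊-Real.log ρ / Real.log D.b⌋₊
  set x := -Real.log r / Real.log D.a
  set x' := -Real.log r / Real.log D.b
  set y := -Real.log ρ / Real.log D.a
  set y' := -Real.log ρ / Real.log D.b
  -- The 5 is the four added digits plus one for rounding down `k`.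
  have c1 : ((min k' (l + (3 + 1)) - k : ℕ) : ℝ) ≤ min x' y - x + 5 := by
    rw [Nat.cast_sub (by omega), Nat.cast_min]
    push_cast
    rcases le_total x' y with h | h
    · rw [min_eq_left h]; linarith [min_le_left (k' : ℝ) (l + 4)]
    · rw [min_eq_right h]; linarith [min_le_right (k' : ℝ) (l + 4)]
  have c2 : ((l + (3 + 1) - k' : ℕ) : ℝ) ≤ y - min x' y + 5 := by
    rcases le_total (l + (3 + 1)) k' with h | h
    · rw [Nat.sub_eq_zero_of_le h, Nat.cast_zero]
      linarith [min_le_right x' y]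
    · rw [Nat.cast_sub h]
      push_cast
      linarith [min_le_left x' y]
  have c3 : ((l' + (3 + 1) - max (l + (3 + 1)) k' : ℕ) : ℝ) ≤ y' - max y x' + 5 := by
    rw [Nat.cast_sub (by omega), Nat.cast_max]
    push_cast
    rcases le_total x' y with h | h
    · rw [max_eq_left h]; linarith [le_max_left (l + 4 : ℝ) k']
    · rw [max_eq_right h]; linarith [le_max_right (l + 4 : ℝ) k']
  have d1 := mul_le_mul_of_nonneg_left c1 D.entropyX_nonneg
  have d2 := mul_le_mul_of_nonneg_left c2 D.entropy_nonneg
  have d3 := mul_le_mul_of_nonneg_left c3 D.entropyY_nonneg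
  linarith

lemma profile_le_localGrowth {r ρ : ℝ} (hρ : 0 < ρ) (hρr : ρ ≤ r) (hr : r ≤ 1) :
    ((profile D.ratio D.dimA D.dimM (-Real.log r) (-Real.log ρ) -
      (5 * (D.entropyX + D.entropy + D.entropyY) + Real.log 49) : ℝ) : EReal) ≤
      localGrowth D.σ r ρ := by
  have hr0 := hρ.trans_le hρr
  have hla := D.log_a_pos
  have hlb := D.log_b_pos
  have hab := D.log_b_lt_log_a
  have hu : 0 ≤ -Real.log r := neg_nonneg.2 (Real.log_nonpos hr0.le hr)
  have huv : -Real.log r ≤ -Real.log ρ := neg_le_neg (Real.log_le_log hρ hρr)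
  have hv := hu.trans huv
  have ha2 : 2 ≤ D.a := D.one_lt_a
  have hl := le_inv_pow_floor ha2 hρ (hρr.trans hr)
  have hl' := le_inv_pow_floor D.two_le_b hρ (hρr.trans hr)
  -- For the lower bound the finer approximation is at scale `r`: the ball must contain every array
  -- with the prescribed digits, to precision `r / 2`.
  have hk := inv_pow_floor_add_le ha2 hr0 (by norm_num : (0 : ℝ) < 2) (j := 1)
    (by simpa using log_two_le ha2)
  have hk' := inv_pow_floor_add_le D.two_le_b hr0 (by norm_num : (0 : ℝ) < 2) (j := 1)
    (by simpa using log_two_le D.two_le_b)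
  have hkk : ⌊-Real.log r / Real.log D.a⌋₊ ≤ ⌊-Real.log r / Real.log D.b⌋₊ :=
    Nat.floor_mono (div_le_div_of_nonneg_left hu hlb hab.le)
  have hll : ⌊-Real.log ρ / Real.log D.a⌋₊ ≤ ⌊-Real.log ρ / Real.log D.b⌋₊ :=
    Nat.floor_mono (div_le_div_of_nonneg_left hv hlb hab.le)
  have hkl' : ⌊-Real.log r / Real.log D.b⌋₊ ≤ ⌊-Real.log ρ / Real.log D.b⌋₊ :=
    Nat.floor_mono (div_le_div_of_nonneg_right huv hlb.le)
  refine le_trans (EReal.coe_le_coe_iff.2 ?_) (sum_le_localGrowth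
    (J := ⌊-Real.log ρ / Real.log D.b⌋₊ + (1 + 1)) (by omega) (by omega) hr0 hk hk' hl hl')
  rw [D.sum_fiberEntropy_mask (by omega) hll (by omega), profile_eq]
  obtain ⟨b1, b1'⟩ := floor_bounds (div_nonneg hu hla.le)
  obtain ⟨b2, b2'⟩ := floor_bounds (div_nonneg hu hlb.le)
  obtain ⟨b3, b3'⟩ := floor_bounds (div_nonneg hv hla.le)
  obtain ⟨b4, b4'⟩ := floor_bounds (div_nonneg hv hlb.le)
  set k := ⌊-Real.log r / Real.log D.a⌋₊
  set k' := ⌊-Real.log r / Real.log D.b⌋₊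
  set l := ⌊-Real.log ρ / Real.log D.a⌋₊
  set l' := ⌊-Real.log ρ / Real.log D.b⌋₊
  set x := -Real.log r / Real.log D.a
  set x' := -Real.log r / Real.log D.b
  set y := -Real.log ρ / Real.log D.a
  set y' := -Real.log ρ / Real.log D.b
  have hsub : ∀ p q : ℕ, (p : ℝ) - q ≤ ((p - q : ℕ) : ℝ) := fun p q => by
    rw [sub_le_iff_le_add]
    exact_mod_cast Nat.sub_le_iff_le_add.1 le_rfl
  have c1 : min x' y - x - 5 ≤ ((min (k' + (1 + 1)) l - (k + (1 + 1)) : ℕ) : ℝ) := by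
    refine le_trans ?_ (hsub _ _)
    rw [Nat.cast_min]
    push_cast
    rcases min_choice (k' + 2 : ℝ) l with h | h
    · rw [h]; linarith [min_le_left x' y]
    · rw [h]; linarith [min_le_right x' y]
  have c2 : y - min x' y - 5 ≤ ((l - (k' + (1 + 1)) : ℕ) : ℝ) := by
    rcases le_total x' y with h | h
    · refine le_trans ?_ (hsub _ _)
      rw [min_eq_left h]
      push_cast
      linarith
    · rw [min_eq_right h]
      have := Nat.cast_nonneg (α := ℝ) (l - (k' + (1 + 1)))
      linarith
  have c3 : y' - max y x' - 5 ≤ ((l' - max l (k' + (1 + 1)) : ℕ) : ℝ) := by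
    refine le_trans ?_ (hsub _ _)
    rw [Nat.cast_max]
    push_cast
    rcases max_choice (l : ℝ) (k' + 2) with h | h
    · rw [h]; linarith [le_max_left y x']
    · rw [h]; linarith [le_max_right y x']
  have d1 := mul_le_mul_of_nonneg_left c1 D.entropyX_nonneg
  have d2 := mul_le_mul_of_nonneg_left c2 D.entropy_nonneg
  have d3 := mul_le_mul_of_nonneg_left c3 D.entropyY_nonneg
  linarith

end CarpetData

/-! ### Properties of the profile -/

lemma profile_mul {κ A M t : ℝ} (ht : 0 ≤ t) (u v : ℝ) :
    profile κ A M (t * u) (t * v) = t * profile κ A M u v := by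
  unfold profile
  rw [mul_div_assoc, ← mul_min_of_nonneg _ _ ht]
  ring

lemma profile_of_le {κ A M u v : ℝ} (h : v ≤ u / κ) : profile κ A M u v = A * (v - u) := by
  unfold profile
  rw [min_eq_left h]
  ring

lemma profile_of_ge {κ A M u v : ℝ} (h : u / κ ≤ v) :
    profile κ A M u v = A * (u / κ - u) + M * (v - u / κ) := by
  unfold profile
  rw [min_eq_right h]

lemma profile_le_mul_sub {κ A M : ℝ} (h : M ≤ A) (u v : ℝ) :
    profile κ A M u v ≤ A * (v - u) := by
  unfold profile
  have := mul_nonneg (sub_nonneg.2 h) (sub_nonneg.2 (min_le_left v (u / κ)))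
  linarith

/-- The effect of changing both scales by a factor `exp c`, as a bi-Lipschitz map does, is bounded.
-/
lemma profile_sub_add_le {κ A M c : ℝ} (hκ : 0 < κ) (hM : 0 ≤ M) (hA : 0 ≤ A) (hc : 0 ≤ c)
    (u v : ℝ) : profile κ A M (u - c) (v + c) ≤
      profile κ A M u v + (A * (2 * c) + M * (c + c / κ)) := by
  unfold profile
  have h0 : 0 ≤ c / κ := by positivity
  rw [sub_div]
  have h1 : min (v + c) (u / κ - c / κ) ≤ min v (u / κ) + c := by
    rw [← min_add_add_right]
    exact min_le_min le_rfl (by linarith)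
  have h2 : min v (u / κ) - c / κ ≤ min (v + c) (u / κ - c / κ) := by
    rw [← min_sub_sub_right]
    exact min_le_min (by linarith) le_rfl
  have h3 := mul_le_mul_of_nonneg_left h1 hA
  have h4 := mul_le_mul_of_nonneg_left h2 hM
  linarith

/-- Used with homogeneity of the profile: letting `t` grow removes the bounded error. -/
lemma le_of_forall_mul_le_mul_add {p q : ℝ} (t₀ K : ℝ)
    (h : ∀ t : ℝ, 0 < t → t₀ ≤ t → t * p ≤ t * q + K) : p ≤ q := by
  by_contra! hpq
  have hd := sub_pos.2 hpq
  have h1 := h (max (max t₀ 1) ((K + 1) / (p - q)))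
    (zero_lt_one.trans_le ((le_max_right _ _).trans (le_max_left _ _)))
    ((le_max_left _ _).trans (le_max_left _ _))
  have h2 := le_max_right (max t₀ 1) ((K + 1) / (p - q))
  rw [div_le_iff₀ hd] at h2
  linarith

/-- Both profiles are piecewise linear in `v`, with kinks at `1 / κ'` and `1 / κ`. Equality up to
the first kink gives `A = A'`, between the kinks `M' = A`, and beyond the second `M = A`. -/
lemma eq_of_profile_eq_of_lt {κ A M κ' A' M' : ℝ} (hκ : 0 < κ) (hκ' : κ' < 1) (hlt : κ < κ')
    (h : ∀ v, 1 < v → profile κ A M 1 v = profile κ' A' M' 1 v) : M = A ∧ M' = A' := by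
  have h0' := hκ.trans hlt
  have i1 : 1 < 1 / κ' := (one_lt_div h0').2 hκ'
  have i2 : 1 / κ' < 1 / κ := one_div_lt_one_div_of_lt hκ hlt
  have e1 := h (1 / κ') i1
  have e2 := h (1 / κ) (i1.trans i2)
  have e3 := h (1 / κ + 1) (by linarith)
  rw [profile_of_le i2.le, profile_of_le le_rfl] at e1
  have hA : A = A' := mul_right_cancel₀ (sub_pos.2 i1).ne' e1
  subst hA
  rw [profile_of_le le_rfl, profile_of_ge i2.le] at e2
  have hM : M' = A := by
    refine mul_right_cancel₀ (sub_pos.2 i2).ne' ?_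
    linarith
  subst hM
  rw [profile_of_ge (by linarith), profile_of_ge (by linarith)] at e3
  exact ⟨by linarith, rfl⟩

/-! ### Comparison of growth rates -/

section General

variable {X Y : Type*} [MetricSpace X] [MetricSpace Y] {T : X → X} {S : Y → Y}

lemma coverNum_mono {M : ℕ} {K K' : Set X} {ε ε' : ℝ} (hK : K ⊆ K') (hε : ε' ≤ ε) :
    coverNum T M K ε ≤ coverNum T M K' ε' := by
  refine le_iInf₂ fun n hn => iInf₂_le n ?_
  obtain ⟨h1, U, ho, hc, hd⟩ := hn
  exact ⟨h1, U, ho, hK.trans hc, fun i y hy z hz => (hd i y hy z hz).trans hε⟩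

lemma localGrowth_le_of_coverNum_le {r ρ r' ρ' : ℝ} (g : Y → X)
    (h : ∀ M y, coverNum S M (bowenBall S M y r) ρ ≤ coverNum T M (bowenBall T M (g y) r') ρ') :
    localGrowth S r ρ ≤ localGrowth T r' ρ' := by
  refine limsup_le_limsup (Eventually.of_forall fun M => ?_)
  refine EReal.div_le_div_right_of_nonneg (EReal.coe_nonneg.2 M.cast_nonneg)
    (iSup_le fun y => ?_)
  refine le_trans ?_ (le_iSup (fun x => logCoverNum T M (bowenBall T M x r') ρ') (g y))
  exact ENNReal.log_le_log (ENat.toENNReal_le.2 (h M y))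

/-- Pull a cover back along `Φ.symm`. Since `Φ` commutes with all iterates, its constant `L` serves
every Bowen metric at once, whatever `M` is. -/
lemma coverNum_le_of_biLipschitz {Φ : X ≃ Y} {L : ℝ} (hL : 1 < L)
    (hΦ : ∀ x x', L⁻¹ * dist x x' ≤ dist (Φ x) (Φ x') ∧ dist (Φ x) (Φ x') ≤ L * dist x x')
    (hT : ∀ x, Φ (T x) = S (Φ x)) (M : ℕ) (y : Y) {r ρ : ℝ} (hr : 0 ≤ r) (hρ : 0 ≤ ρ) :
    coverNum S M (bowenBall S M y r) ρ ≤
      coverNum T M (bowenBall T M (Φ.symm y) (L * r)) (ρ / L) := by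
  have hL0 : 0 < L := zero_lt_one.trans hL
  have hit : ∀ (m : ℕ) x, Φ (T^[m] x) = S^[m] (Φ x) := fun m =>
    (Function.Semiconj.iterate_right hT m).eq
  have hinv : ∀ x x', dist x x' ≤ L * dist (Φ x) (Φ x') := fun x x' => by
    have := (hΦ x x').1
    rwa [inv_mul_le_iff₀ hL0] at this
  have hcont : Continuous Φ.symm := by
    refine LipschitzWith.continuous (K := ⟨L, hL0.le⟩) (LipschitzWith.of_dist_le_mul fun y y' => ?_)
    have := hinv (Φ.symm y) (Φ.symm y')
    rwa [Φ.apply_symm_apply, Φ.apply_symm_apply] at this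
  refine le_iInf₂ fun n hn => iInf₂_le n ?_
  obtain ⟨h1, U, ho, hc, hd⟩ := hn
  refine ⟨h1, fun i => Φ.symm ⁻¹' U i, fun i => (ho i).preimage hcont, fun z hz => ?_,
    fun i z hz w hw => ?_⟩
  · have hz' : Φ.symm z ∈ bowenBall T M (Φ.symm y) (L * r) := by
      refine bowenDist_le (by positivity) fun m hm => (hinv _ _).trans ?_
      rw [hit, hit, Φ.apply_symm_apply, Φ.apply_symm_apply]
      exact mul_le_mul_of_nonneg_left ((dist_le_bowenDist S M y z hm).trans hz) hL0.le
    simpa using hc hz'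
  · refine bowenDist_le hρ fun m hm => ?_
    have h2 := (dist_le_bowenDist T M _ _ hm).trans (hd i _ hz _ hw)
    have h3 := (hΦ (T^[m] (Φ.symm z)) (T^[m] (Φ.symm w))).2
    rw [hit, hit, Φ.apply_symm_apply, Φ.apply_symm_apply] at h3
    rw [le_div_iff₀ hL0] at h2
    linarith

lemma BiLipschitzIsomorphic.symm (h : BiLipschitzIsomorphic T S) : BiLipschitzIsomorphic S T := by
  obtain ⟨Φ, ⟨L, hL, hΦ⟩, hT⟩ := h
  have hL0 : 0 < L := zero_lt_one.trans hL
  refine ⟨Φ.symm, ⟨L, hL, fun y y' => ?_⟩, fun y => ?_⟩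
  · have h1 := hΦ (Φ.symm y) (Φ.symm y')
    rw [Φ.apply_symm_apply, Φ.apply_symm_apply, inv_mul_le_iff₀ hL0] at h1
    exact ⟨(inv_mul_le_iff₀ hL0).2 h1.2, h1.1⟩
  · rw [Equiv.symm_apply_eq, hT, Φ.apply_symm_apply]

lemma exp_le_ofReal_mul_rpow_iff {x : EReal} {C q s : ℝ} (hC : 0 < C) (hq : 0 < q) :
    EReal.exp x ≤ ENNReal.ofReal (C * q ^ s) ↔ x ≤ ((Real.log C + s * Real.log q : ℝ) : EReal) := by
  have h : C * q ^ s = Real.exp (Real.log C + s * Real.log q) := by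
    rw [Real.exp_add, Real.exp_log hC, Real.rpow_def_of_pos hq, mul_comm s]
  rw [h, ← EReal.exp_coe, EReal.exp_le_exp_iff]

lemma iInf_coe_eq {Q : ℝ → Prop} {A : ℝ} (hA : 0 ≤ A) (h1 : ∀ s, A < s → Q s)
    (h2 : ∀ s, Q s → A ≤ s) : (⨅ (s : ℝ) (_ : 0 < s ∧ Q s), (s : EReal)) = A := by
  refine le_antisymm ?_ (le_iInf₂ fun s hs => EReal.coe_le_coe_iff.2 (h2 s hs.2))
  refine EReal.le_of_forall_lt_iff_le.1 fun s hs => ?_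
  have hs' := EReal.coe_lt_coe_iff.1 hs
  exact iInf₂_le s ⟨hA.trans_lt hs', h1 s hs'⟩

end General

/-! ### Dimensions, spectrum and bi-Lipschitz comparison from the profile -/

namespace CarpetData

variable (D : CarpetData)

/-- A bound for the difference of the growth rate and the profile. -/
def growthError : ℝ := 5 * (D.entropyX + D.entropy + D.entropyY) + Real.log 49

variable {D}

lemma bowenBall_eq_univ {r : ℝ} (hr : 1 ≤ r) (M : ℕ) (p : D.carpet) :
    bowenBall D.σ M p r = univ :=
  eq_univ_of_forall fun _ => bowenDist_le (zero_le_one.trans hr) fun _ _ =>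
    (CubePair.dist_le_one _ _).trans hr

lemma dimA_nonneg : 0 ≤ D.dimA := D.dimM_nonneg.trans D.dimM_le_dimA

lemma localGrowth_le_dimA_mul {r ρ : ℝ} (hρ : 0 < ρ) (hρr : ρ < r) :
    localGrowth D.σ r ρ ≤ ((D.dimA * Real.log (r / ρ) + D.growthError : ℝ) : EReal) := by
  have hr := hρ.trans hρr
  -- The profile estimate needs scales at most 1. Clipping at 1 loses nothing, because the space has
  -- diameter at most 1.
  have h1 : localGrowth D.σ r ρ ≤ localGrowth D.σ (min r 1) (min ρ 1) := by
    refine localGrowth_le_of_coverNum_le id fun M p => coverNum_mono ?_ (min_le_left _ _)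
    rcases le_total r 1 with h | h
    · rw [min_eq_left h, id]
    · rw [min_eq_right h, bowenBall_eq_univ (p := id p) le_rfl]
      exact subset_univ _
  refine h1.trans ((D.localGrowth_le_profile (lt_min hρ one_pos) (min_le_min hρr.le le_rfl)
    (min_le_right _ _)).trans (EReal.coe_le_coe_iff.2 (add_le_add_left ?_ _)))
  refine (profile_le_mul_sub D.dimM_le_dimA _ _).trans
    (mul_le_mul_of_nonneg_left ?_ dimA_nonneg)
  rw [Real.log_div hr.ne' hρ.ne']
  rcases le_total r 1 with h | h
  · rw [min_eq_left h, min_eq_left (hρr.le.trans h)]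
    linarith
  · rw [min_eq_right h, Real.log_one]
    rcases le_total ρ 1 with h' | h'
    · rw [min_eq_left h']
      linarith [Real.log_nonneg h]
    · rw [min_eq_right h', Real.log_one]
      linarith [Real.log_le_log hρ hρr.le]

variable (D)

theorem meanAssouadDim_eq : meanAssouadDim D.σ = (D.dimA : EReal) := by
  refine iInf_coe_eq dimA_nonneg (fun s hs => ⟨Real.exp D.growthError, Real.exp_pos _,
    fun r ρ hρ hρr => ?_⟩) ?_
  · have hq : 1 < r / ρ := (one_lt_div hρ).2 hρr
    rw [exp_le_ofReal_mul_rpow_iff (Real.exp_pos _) (zero_lt_one.trans hq), Real.log_exp]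
    refine (localGrowth_le_dimA_mul hρ hρr).trans (EReal.coe_le_coe_iff.2 ?_)
    have := mul_le_mul_of_nonneg_right hs.le (Real.log_nonneg hq.le)
    linarith
  · rintro s ⟨C, hC, h⟩
    have hκ := sub_pos.2 D.ratio_lt_one
    -- The scales `exp (-(t * κ))` and `exp (-t)` put `v = u / κ`, the end of the range where the
    -- profile has slope `A`; there it equals `A * t * (1 - κ)`.
    refine le_of_mul_le_mul_right (le_of_forall_mul_le_mul_add 0 (Real.log C + D.growthError)
      fun t ht _ => ?_) hκ
    have hlt : t * D.ratio < t := mul_lt_of_lt_one_right ht D.ratio_lt_one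
    have hexp : Real.exp (-t) < Real.exp (-(t * D.ratio)) := Real.exp_lt_exp.2 (by linarith)
    have h1 := h _ _ (Real.exp_pos _) hexp
    rw [exp_le_ofReal_mul_rpow_iff hC (div_pos (Real.exp_pos _) (Real.exp_pos _)),
      ← Real.exp_sub, Real.log_exp] at h1
    have h2 := EReal.coe_le_coe_iff.1 ((D.profile_le_localGrowth (Real.exp_pos _) hexp.le
      (Real.exp_le_one_iff.2 (neg_nonpos.2 (mul_pos ht D.ratio_pos).le))).trans h1)
    rw [Real.log_exp, Real.log_exp, neg_neg, neg_neg, profile_of_le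
      (mul_div_cancel_right₀ t D.ratio_pos.ne').ge] at h2
    unfold growthError
    linarith

theorem meanAssouadSpectrum_eq {θ : ℝ} (h0 : 0 < θ) (h1 : θ < 1) :
    meanAssouadSpectrum D.σ θ =
      ((profile D.ratio D.dimA D.dimM 1 (1 / θ) / (1 / θ - 1) : ℝ) : EReal) := by
  have hθ : 1 < 1 / θ := (one_lt_div h0).2 h1
  have hpos : 0 < 1 / θ - 1 := sub_pos.2 hθ
  have hlog : ∀ r : ℝ, 0 < r → Real.log (r / r ^ (1 / θ)) = -Real.log r * (1 / θ - 1) := by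
    intro r hr
    rw [Real.log_div hr.ne' (Real.rpow_pos_of_pos hr _).ne', Real.log_rpow hr]
    ring
  have hprof : ∀ r : ℝ, 0 < r → r < 1 →
      profile D.ratio D.dimA D.dimM (-Real.log r) (-Real.log (r ^ (1 / θ))) =
        -Real.log r * profile D.ratio D.dimA D.dimM 1 (1 / θ) := by
    intro r hr hr1
    rw [← profile_mul (neg_nonneg.2 (Real.log_nonpos hr.le hr1.le)), Real.log_rpow hr]
    congr 1 <;> ring
  have hle : ∀ r : ℝ, 0 < r → r < 1 → r ^ (1 / θ) ≤ r := fun r hr hr1 =>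
    (Real.rpow_le_rpow_of_exponent_ge hr hr1.le hθ.le).trans_eq (Real.rpow_one r)
  refine iInf_coe_eq (div_nonneg ?_ hpos.le) (fun s hs => ⟨Real.exp D.growthError, Real.exp_pos _,
    fun r hr hr1 => ?_⟩) ?_
  · unfold profile
    have h2 : 1 ≤ min (1 / θ) (1 / D.ratio) :=
      le_min hθ.le ((one_le_div D.ratio_pos).2 D.ratio_lt_one.le)
    exact add_nonneg (mul_nonneg dimA_nonneg (sub_nonneg.2 h2))
      (mul_nonneg D.dimM_nonneg (sub_nonneg.2 (min_le_left _ _)))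
  · rw [exp_le_ofReal_mul_rpow_iff (Real.exp_pos _) (div_pos hr (Real.rpow_pos_of_pos hr _)),
      Real.log_exp, hlog r hr]
    refine (D.localGrowth_le_profile (Real.rpow_pos_of_pos hr _) (hle r hr hr1) hr1.le).trans
      (EReal.coe_le_coe_iff.2 ?_)
    rw [hprof r hr hr1]
    rw [div_lt_iff₀ hpos] at hs
    have := mul_le_mul_of_nonneg_left hs.le (neg_nonneg.2 (Real.log_nonpos hr.le hr1.le))
    unfold growthError
    linarith
  · rintro s ⟨C, hC, h⟩
    rw [div_le_iff₀ hpos]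
    refine le_of_forall_mul_le_mul_add 0 (Real.log C + D.growthError) fun t ht _ => ?_
    have hr := Real.exp_pos (-t)
    have hr1 : Real.exp (-t) < 1 := Real.exp_lt_one_iff.2 (neg_lt_zero.2 ht)
    have h2 := h _ hr hr1
    rw [exp_le_ofReal_mul_rpow_iff hC (div_pos hr (Real.rpow_pos_of_pos hr _)), hlog _ hr] at h2
    have h3 := EReal.coe_le_coe_iff.1 ((D.profile_le_localGrowth (Real.rpow_pos_of_pos hr _)
      (hle _ hr hr1) hr1.le).trans h2)
    rw [hprof _ hr hr1, Real.log_exp, neg_neg] at h3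
    unfold growthError
    linarith

lemma limsup_logCoverNum_div {ε : ℝ} (h0 : 0 < ε) (h1 : ε < 1) :
    limsup (fun M : ℕ => logCoverNum D.σ M univ ε / ((M * Real.log (1 / ε) : ℝ) : EReal)) atTop =
      (((Real.log (1 / ε))⁻¹ : ℝ) : EReal) * localGrowth D.σ 1 ε := by
  have hlog : 0 < Real.log (1 / ε) := Real.log_pos ((one_lt_div h0).2 h1)
  unfold localGrowth
  rw [← EReal.limsup_const_mul_of_nonneg_of_ne_top (EReal.coe_nonneg.2 (inv_pos.2 hlog).le)
    (EReal.coe_ne_top _)]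
  refine congrArg (fun f => limsup f atTop) (funext fun M => ?_)
  simp_rw [bowenBall_eq_univ le_rfl]
  rw [iSup_const, mul_comm (M : ℝ), EReal.coe_mul, EReal.div_eq_inv_mul, EReal.mul_inv, mul_assoc,
    ← EReal.div_eq_inv_mul (logCoverNum D.σ M univ ε), EReal.coe_inv]

theorem tendsto_metricMeanDim : Tendsto (fun ε : ℝ => limsup (fun M : ℕ =>
    logCoverNum D.σ M univ ε / ((M * Real.log (1 / ε) : ℝ) : EReal)) atTop) (𝓝[>] 0)
      (𝓝 (D.dimM : EReal)) := by
  have hinv : Tendsto (fun ε : ℝ => (Real.log (1 / ε))⁻¹) (𝓝[>] 0) (𝓝 0) := by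
    refine tendsto_inv_atTop_zero.comp ?_
    simp_rw [one_div, Real.log_inv]
    exact tendsto_neg_atBot_atTop.comp Real.tendsto_log_nhdsGT_zero
  have hlim : ∀ c : ℝ, Tendsto (fun ε : ℝ => ((D.dimM + (Real.log (1 / ε))⁻¹ * c : ℝ) : EReal))
      (𝓝[>] 0) (𝓝 (D.dimM : EReal)) := by
    intro c
    refine (continuous_coe_real_ereal.tendsto _).comp ?_
    simpa using (hinv.mul_const c).const_add D.dimM
  have hev : ∀ᶠ ε : ℝ in 𝓝[>] 0, 0 < ε ∧ ε < 1 := Ioo_mem_nhdsGT one_pos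
  -- At `u = 0` the kink sits at 0, so the profile is `dimM * log (1 / ε)` and the bounded error is
  -- divided by `log (1 / ε)`.
  have hkey : ∀ {ε : ℝ}, 0 < ε → ε < 1 → ∀ c : ℝ, D.dimM + (Real.log (1 / ε))⁻¹ * c =
      (Real.log (1 / ε))⁻¹ *
        (profile D.ratio D.dimA D.dimM (-Real.log 1) (-Real.log ε) + c) := by
    intro ε h0 h1 c
    have hlog : 0 < Real.log (1 / ε) := Real.log_pos ((one_lt_div h0).2 h1)
    have h2 : -Real.log ε = Real.log (1 / ε) := by rw [one_div, Real.log_inv]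
    rw [h2, Real.log_one, neg_zero, profile_of_ge (by simpa using hlog.le)]
    field_simp
    ring
  refine tendsto_of_tendsto_of_tendsto_of_le_of_le' (hlim (-D.growthError)) (hlim D.growthError)
    ?_ ?_
  · filter_upwards [hev] with ε hε
    rw [D.limsup_logCoverNum_div hε.1 hε.2, hkey hε.1 hε.2, EReal.coe_mul]
    refine mul_le_mul_of_nonneg_left (D.profile_le_localGrowth hε.1 hε.2.le le_rfl)
      (EReal.coe_nonneg.2 (inv_nonneg.2 (Real.log_nonneg ?_)))
    exact ((one_lt_div hε.1).2 hε.2).le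
  · filter_upwards [hev] with ε hε
    rw [D.limsup_logCoverNum_div hε.1 hε.2, hkey hε.1 hε.2, EReal.coe_mul]
    refine mul_le_mul_of_nonneg_left (D.localGrowth_le_profile hε.1 hε.2.le le_rfl)
      (EReal.coe_nonneg.2 (inv_nonneg.2 (Real.log_nonneg ?_)))
    exact ((one_lt_div hε.1).2 hε.2).le

theorem upperMetricMeanDim_eq : upperMetricMeanDim D.σ = (D.dimM : EReal) :=
  D.tendsto_metricMeanDim.limsup_eq

theorem lowerMetricMeanDim_eq : lowerMetricMeanDim D.σ = (D.dimM : EReal) :=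
  D.tendsto_metricMeanDim.liminf_eq

variable {D} in
lemma profile_le_of_biLipschitz {E : CarpetData} (h : BiLipschitzIsomorphic D.σ E.σ) {u v : ℝ}
    (hu : 0 < u) (huv : u < v) :
    profile E.ratio E.dimA E.dimM u v ≤ profile D.ratio D.dimA D.dimM u v := by
  obtain ⟨Φ, ⟨L, hL, hΦ⟩, hT⟩ := h
  have hL0 : 0 < L := zero_lt_one.trans hL
  set c := Real.log L
  have hc : 0 < c := Real.log_pos hL
  -- The threshold `c / u` guarantees `L * exp (-(t * u)) ≤ 1`, as the upper profile estimate
  -- requires.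
  refine le_of_forall_mul_le_mul_add (c / u) (D.growthError + E.growthError +
    (D.dimA * (2 * c) + D.dimM * (c + c / D.ratio))) fun t ht htu => ?_
  rw [div_le_iff₀ hu] at htu
  have htuv : t * u ≤ t * v := mul_le_mul_of_nonneg_left huv.le ht.le
  have h1 := E.profile_le_localGrowth (Real.exp_pos (-(t * v)))
    (Real.exp_le_exp.2 (neg_le_neg htuv)) (Real.exp_le_one_iff.2 (by nlinarith))
  have h2 := localGrowth_le_of_coverNum_le (r := Real.exp (-(t * u))) (ρ := Real.exp (-(t * v)))
    Φ.symm fun M y =>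
      coverNum_le_of_biLipschitz hL hΦ hT M y (Real.exp_pos _).le (Real.exp_pos _).le
  have e1 : L * Real.exp (-(t * u)) = Real.exp (-(t * u - c)) := by
    rw [neg_sub, Real.exp_sub, Real.exp_log hL0, Real.exp_neg]
    rfl
  have e2 : Real.exp (-(t * v)) / L = Real.exp (-(t * v + c)) := by
    rw [neg_add, Real.exp_add, Real.exp_neg c, Real.exp_log hL0]
    rfl
  rw [e1, e2] at h2
  have h3 := D.localGrowth_le_profile (Real.exp_pos (-(t * v + c)))
    (Real.exp_le_exp.2 (by linarith : -(t * v + c) ≤ -(t * u - c)))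
    (Real.exp_le_one_iff.2 (by linarith))
  have h4 := EReal.coe_le_coe_iff.1 ((h1.trans h2).trans h3)
  simp only [Real.log_exp, neg_neg] at h4
  have h5 := profile_sub_add_le (A := D.dimA) (M := D.dimM) D.ratio_pos D.dimM_nonneg dimA_nonneg
    hc.le (t * u) (t * v)
  rw [profile_mul ht.le] at h4 h5
  unfold growthError
  linarith

end CarpetData

end MeanAssouad
end

/-! ### The main theorem -/

open MeanAssouad in
theorem mainTheorem2 (D : MeanAssouad.CarpetData) :
    -- existence and finiteness of the metric mean dimension `M` and of the mean Assouad
    -- dimension `A`, and the formula for the spectrum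
    (∃ M A : ℝ,
      MeanAssouad.lowerMetricMeanDim D.σ = (M : EReal) ∧
      MeanAssouad.upperMetricMeanDim D.σ = (M : EReal) ∧
      MeanAssouad.meanAssouadDim D.σ = (A : EReal) ∧
      (∀ θ : ℝ, 0 < θ → θ ≤ Real.log D.b / Real.log D.a →
        MeanAssouad.meanAssouadSpectrum D.σ θ =
          (((M - θ * (A - (A - M) * (Real.log D.a / Real.log D.b))) / (1 - θ) : ℝ) : EReal)) ∧
      (∀ θ : ℝ, Real.log D.b / Real.log D.a < θ → θ < 1 →
        MeanAssouad.meanAssouadSpectrum D.σ θ = (A : EReal))) ∧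
    -- the spectrum is determined by the ratio and the two dimensions
    (∀ E : MeanAssouad.CarpetData, D.ratio = E.ratio →
      MeanAssouad.upperMetricMeanDim D.σ = MeanAssouad.upperMetricMeanDim E.σ →
      MeanAssouad.meanAssouadDim D.σ = MeanAssouad.meanAssouadDim E.σ →
      ∀ θ : ℝ, 0 < θ → θ < 1 →
        MeanAssouad.meanAssouadSpectrum D.σ θ = MeanAssouad.meanAssouadSpectrum E.σ θ) ∧
    -- bi-Lipschitz invariance of the ratio
    (∀ E : MeanAssouad.CarpetData, MeanAssouad.BiLipschitzIsomorphic D.σ E.σ →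
      MeanAssouad.upperMetricMeanDim D.σ ≠ MeanAssouad.meanAssouadDim D.σ →
      D.ratio = E.ratio) := by
  refine ⟨⟨D.dimM, D.dimA, D.lowerMetricMeanDim_eq, D.upperMetricMeanDim_eq, D.meanAssouadDim_eq,
    fun θ h0 hθ => ?_, fun θ hθ h1 => ?_⟩, fun E hr hM hA θ h0 h1 => ?_, fun E h hne => ?_⟩
  · change θ ≤ D.ratio at hθ
    have h1 : θ < 1 := hθ.trans_lt D.ratio_lt_one
    have hab : Real.log D.a / Real.log D.b = 1 / D.ratio := (one_div_div _ _).symm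
    have hκ := D.ratio_pos
    rw [D.meanAssouadSpectrum_eq h0 h1, profile_of_ge (one_div_le_one_div_of_le h0 hθ), hab,
      EReal.coe_eq_coe_iff]
    have h2 : 1 - θ ≠ 0 := (sub_pos.2 h1).ne'
    have h3 : 1 / θ - 1 = (1 - θ) / θ := by field_simp
    rw [h3]
    field_simp
    ring
  · change D.ratio < θ at hθ
    have h0 : 0 < θ := D.ratio_pos.trans hθ
    rw [D.meanAssouadSpectrum_eq h0 h1,
      profile_of_le (one_div_le_one_div_of_le D.ratio_pos hθ.le), EReal.coe_eq_coe_iff,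
      mul_div_cancel_right₀ _ (sub_pos.2 ((one_lt_div h0).2 h1)).ne']
  · rw [D.upperMetricMeanDim_eq, E.upperMetricMeanDim_eq, EReal.coe_eq_coe_iff] at hM
    rw [D.meanAssouadDim_eq, E.meanAssouadDim_eq, EReal.coe_eq_coe_iff] at hA
    rw [D.meanAssouadSpectrum_eq h0 h1, E.meanAssouadSpectrum_eq h0 h1, hr, hM, hA]
  · rw [D.upperMetricMeanDim_eq, D.meanAssouadDim_eq, ne_eq, EReal.coe_eq_coe_iff] at hne
    have hprof : ∀ v, 1 < v → profile D.ratio D.dimA D.dimM 1 v =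
        profile E.ratio E.dimA E.dimM 1 v := fun v hv =>
      le_antisymm (CarpetData.profile_le_of_biLipschitz h.symm one_pos hv)
        (CarpetData.profile_le_of_biLipschitz h one_pos hv)
    rcases lt_trichotomy D.ratio E.ratio with hlt | heq | hlt
    · exact absurd (eq_of_profile_eq_of_lt D.ratio_pos E.ratio_lt_one hlt hprof).1 hne
    · exact heq
    · exact absurd (eq_of_profile_eq_of_lt E.ratio_pos D.ratio_lt_one hlt
        fun v hv => (hprof v hv).symm).2 hne
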